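/- Let $p$ be a prime, $q = p^r$ with $r \ge 1$, $n$ a non-negative integer, $l$ a prime with $l \neq 2, p$, and $k$ a field with $\operatorname{char} k \neq l$. For $a \in \mathbb{F}_{q^2}$ write $\overline{a} = a^q$, and apply this entrywise to matrices. Let $\beta$ be an invertible $n \times n$ matrix over $\mathbb{F}_{q^2}$ that is Hermitian, i.e. $\beta^T = \overline{\beta}$, and put $$SU(n,q^2) = \{M \in GL_n(\mathbb{F}_{q^2}) : M^T \beta \overline{M} = \beta,\ \det M = 1\}, \qquad PSU(n,q^2) = SU(n,q^2)/Z(SU(n,q^2)).$$ For a finite group $G$, a field extension $F/k$ and a $G$-torsor $T$ over $\operatorname{Spec} F$ (equivalently, a Galois $G$-algebra over $F$), let $\operatorname{ed}_k(T)$ be the minimum of $\operatorname{trdeg}_k(E)$ over the fields $k \subseteq E \subseteq F$ such that $T$ is isomorphic to the base change to $F$ of a $G$-torsor over $\operatorname{Spec} E$, and let $\operatorname{ed}_k(T,l)$ be the minimum of $\operatorname{ed}_k(T_{F'})$ over the finite extensions $F'/F$ with $l \nmid [F':F]$. The essential $l$-dimension $\operatorname{ed}_k(G,l)$ is the supremum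 of $\operatorname{ed}_k(T,l)$ over all field extensions $F/k$ and all $G$-torsors $T$ over $\operatorname{Spec} F$. Then $$\operatorname{ed}_k(PSU(n,q^2),l) = \begin{cases} \operatorname{ed}_k(SU(n,q^2),l), & l \nmid n \text{ or } l \nmid q+1,\\ \operatorname{ed}_k(PSL_n(\mathbb{F}_{q^2}),l), & l \mid n \text{ and } l \mid q+1. \end{cases}$$ Moreover, if $l \mid n$ and $l \mid q+1$, then the Sylow $l$-subgroups of $PSU(n,q^2)$ are isomorphic to the Sylow $l$-subgroups of $PSL_n(\mathbb{F}_{q^2})$. -/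

import Mathlib

open scoped TensorProduct

universe u v

noncomputable section

/-! ### Torsors under a finite group, and essential dimension at a prime -/

/-- A commutative `F`-algebra with a left action of `G` by `F`-algebra automorphisms, i.e. an
affine `F`-scheme with a right `G`-action. -/
structure GAlgebra (G : Type v) [Group G] (F : Type u) [Field F] where
  carrier : Type u
  [commRing : CommRing carrier]
  [algebra : Algebra F carrier]
  act : G →* (carrier ≃ₐ[F] carrier)

namespace GAlgebra

attribute [instance] GAlgebra.commRing GAlgebra.algebra

variable {G : Type v} [Group G] {F : Type u} [Field F]

/-- The map `A ⊗ A → ∏_{g ∈ G} A`, `a ⊗ b ↦ (a * g b)_g`; on spectra it is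
`X × G → X × X`, `(x, g) ↦ (x, x g)`. -/
def torsorMap (A : GAlgebra G F) : A.carrier ⊗[F] A.carrier →ₐ[F] (G → A.carrier) :=
  AlgHom.pi fun g =>
    Algebra.TensorProduct.productMap (AlgHom.id F A.carrier) (A.act g).toAlgHom

/-- `A` is a Galois `G`-algebra over `F`; equivalently `Spec A` is a `G`-torsor over `Spec F`. -/
structure IsTorsor (A : GAlgebra G F) : Prop where
  nontrivial : Nontrivial A.carrier
  finite : Module.Finite F A.carrier
  bijective : Function.Bijective A.torsorMap

/-- Two `G`-algebras over `F` are isomorphic, by a `G`-equivariant `F`-algebra isomorphism. -/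
def Iso (A B : GAlgebra G F) : Prop :=
  ∃ e : A.carrier ≃ₐ[F] B.carrier, ∀ (g : G) (a : A.carrier), e (A.act g a) = B.act g (e a)

/-- Extension of scalars of a `G`-algebra along `F → K`; `G` acts through the second factor. -/
def baseChange (A : GAlgebra G F) (K : Type u) [Field K] [Algebra F K] : GAlgebra G K where
  carrier := K ⊗[F] A.carrier
  act :=
    { toFun := fun g => Algebra.TensorProduct.congr AlgEquiv.refl (A.act g)
      map_one' := by
        ext x
        induction x using TensorProduct.induction_on with
        | zero => simp
        | tmul a b => simp
        | add a b ha hb => simp only [map_add, ha, hb]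
      map_mul' := by
        intro g h
        ext x
        induction x using TensorProduct.induction_on with
        | zero => simp
        | tmul a b => simp
        | add a b ha hb => simp only [map_add, ha, hb] }

/-- The essential dimension of (the class of) a `G`-torsor `A` over an extension `F` of `k`: the
least transcendence degree over `k` of an intermediate field `k ⊆ E ⊆ F` such that `A` is
isomorphic to the base change of a `G`-torsor over `E`. -/
def essDim (k : Type u) [Field k] [Algebra k F] (A : GAlgebra G F) : ℕ∞ :=
  ⨅ (E : IntermediateField k F) (B : GAlgebra G E) (_ : B.IsTorsor)
    (_ : (B.baseChange F).Iso A), Cardinal.toENat (Algebra.trdeg k E)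

/-- The essential `l`-dimension of (the class of) a `G`-torsor `A` over an extension `F` of `k`:
the least essential dimension of `A` after a finite extension `F'/F` of degree prime to `l`. -/
def essDimAt (k : Type u) [Field k] [Algebra k F] (A : GAlgebra G F) (l : ℕ) : ℕ∞ :=
  ⨅ (F' : Type u) (_ : Field F') (_ : Algebra k F') (_ : Algebra F F')
    (_ : IsScalarTower k F F') (_ : FiniteDimensional F F')
    (_ : ¬ l ∣ Module.finrank F F'), (A.baseChange F').essDim k

end GAlgebra

/-- The essential `l`-dimension `ed_k(G, l)` of a finite group `G`: the supremum of the essential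
`l`-dimensions of all `G`-torsors over all field extensions of `k`. -/
def essentialDimensionAt (k : Type u) [Field k] (G : Type v) [Group G] (l : ℕ) : ℕ∞ :=
  ⨆ (F : Type u) (_ : Field F) (_ : Algebra k F) (A : GAlgebra G F) (_ : A.IsTorsor),
    A.essDimAt k l

/-! ### Unitary groups over finite fields -/

/-- The unitary group `{M ∈ GL_n(K) : Mᵀ β M̄ = β}`, where the bar is the entrywise
application of `σ`. -/
def unitaryGroupOf {K : Type u} [Field K] (σ : K →+* K) {n : ℕ} (β : Matrix (Fin n) (Fin n) K) :
    Subgroup (GL (Fin n) K) where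
  carrier := {M | (M : Matrix (Fin n) (Fin n) K).transpose * β *
    (M : Matrix (Fin n) (Fin n) K).map σ = β}
  one_mem' := by simp
  mul_mem' := by
    intro M N hM hN
    simp only [Set.mem_ofPred_eq] at hM hN ⊢
    rw [Units.val_mul, Matrix.transpose_mul, Matrix.map_mul]
    calc _ = (N : Matrix (Fin n) (Fin n) K).transpose *
          ((M : Matrix (Fin n) (Fin n) K).transpose * β *
            (M : Matrix (Fin n) (Fin n) K).map σ) * (N : Matrix (Fin n) (Fin n) K).map σ := by
            simp only [Matrix.mul_assoc]
      _ = β := by rw [hM, hN]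
  inv_mem' := by
    intro M hM
    simp only [Set.mem_ofPred_eq] at hM ⊢
    have h1 : ((M⁻¹ : GL (Fin n) K) : Matrix (Fin n) (Fin n) K).transpose *
        (M : Matrix (Fin n) (Fin n) K).transpose = 1 := by
      rw [← Matrix.transpose_mul, ← Units.val_mul]; simp
    have h2 : (M : Matrix (Fin n) (Fin n) K).map σ *
        ((M⁻¹ : GL (Fin n) K) : Matrix (Fin n) (Fin n) K).map σ = 1 := by
      rw [← Matrix.map_mul, ← Units.val_mul]; simp
    calc _ = ((M⁻¹ : GL (Fin n) K) : Matrix (Fin n) (Fin n) K).transpose *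
          ((M : Matrix (Fin n) (Fin n) K).transpose * β * (M : Matrix (Fin n) (Fin n) K).map σ) *
            ((M⁻¹ : GL (Fin n) K) : Matrix (Fin n) (Fin n) K).map σ := by rw [hM]
      _ = (((M⁻¹ : GL (Fin n) K) : Matrix (Fin n) (Fin n) K).transpose *
          (M : Matrix (Fin n) (Fin n) K).transpose) * β * ((M : Matrix (Fin n) (Fin n) K).map σ *
            ((M⁻¹ : GL (Fin n) K) : Matrix (Fin n) (Fin n) K).map σ) := by
            simp only [Matrix.mul_assoc]
      _ = β := by rw [h1, h2, Matrix.one_mul, Matrix.mul_one]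

/-- The special unitary group: the elements of determinant one of the unitary group. -/
def specialUnitaryGroupOf {K : Type u} [Field K] (σ : K →+* K) {n : ℕ}
    (β : Matrix (Fin n) (Fin n) K) : Subgroup (GL (Fin n) K) :=
  unitaryGroupOf σ β ⊓ (Matrix.GeneralLinearGroup.det : GL (Fin n) K →* Kˣ).ker

/-- The conjugation `a ↦ ā = a ^ q` of the field with `q ^ 2` elements, where `q = p ^ r`: the
nontrivial automorphism over the subfield with `q` elements. -/
def conjFq (p : ℕ) [Fact p.Prime] (r : ℕ) : GaloisField p (2 * r) →+* GaloisField p (2 * r) :=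
  iterateFrobenius (GaloisField p (2 * r)) p r

/-- `SU(n, q ^ 2)` with respect to the Hermitian matrix `β`, where `q = p ^ r`. -/
abbrev SU (p : ℕ) [Fact p.Prime] (r n : ℕ) (β : Matrix (Fin n) (Fin n) (GaloisField p (2 * r))) :
    Type :=
  specialUnitaryGroupOf (conjFq p r) β

/-- `PSU(n, q ^ 2)`: the quotient of `SU(n, q ^ 2)` by its center. -/
abbrev PSU (p : ℕ) [Fact p.Prime] (r n : ℕ) (β : Matrix (Fin n) (Fin n) (GaloisField p (2 * r))) :
    Type :=
  SU p r n β ⧸ Subgroup.center (SU p r n β)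

end

/-! The essential `l`-dimension does not change on passing to a subgroup `H` of `G` of index prime
to `l` (`essentialDimensionAt_eq_of_injective`). If the `G`-torsor induced from an `H`-torsor `B`
over `F` descends to `A` over `E`, then the invariants `A^H` map to `B^H = F` with image algebraic
over `E`, and the fibre of `A` over this point descends `B` to a field of the same transcendence
degree. Conversely, a `G`-torsor `A` reduces to `H` over every residue field of `A^H`. Since `A^H`
has dimension `[G : H]`, some residue field has degree prime to `l`, and inducing a descent of the
reduced torsor gives a descent of `A`.

The rest is group theory. An orthonormal basis replaces `β` by the identity matrix, and then enough
diagonal and monomial elements are at hand to see that the center of `SU` consists of scalars `c`,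
with `c ^ n = 1` and `c ^ (q + 1) = 1`. If `l ∤ n` or `l ∤ q + 1`, the center has order prime to
`l`, so a Sylow `l`-subgroup of `SU` embeds in `PSU` with index prime to `l`.

If `l ∣ q + 1`, then `PSU` embeds in `PSL_n` because the centers correspond. The unitary group
contains the monomial matrices with entries of norm one, a group of order `(q + 1) ^ n * n!`; by
lifting the exponent this is already the full `l`-part of the order of `GL_n` over the field with `q
^ 2` elements. Dividing out determinants, the index of `PSU` in `PSL_n` is prime to `l`, which gives
both the essential dimension and the Sylow subgroups. -/

namespace GAlgebra

/-! ### Galois algebras through dual systems and traces -/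

section Criterion

variable {G : Type*} [Group G] {F : Type u} [Field F] {A : GAlgebra G F}

@[simp]
theorem torsorMap_tmul (A : GAlgebra G F) (a b : A.carrier) (g : G) :
    A.torsorMap (a ⊗ₜ b) g = a * A.act g b := by
  simp [torsorMap]

theorem act_mul_apply (A : GAlgebra G F) (g h : G) (a : A.carrier) :
    A.act (g * h) a = A.act g (A.act h a) := by
  rw [map_mul]; rfl

theorem act_one_apply (A : GAlgebra G F) (a : A.carrier) : A.act 1 a = a := by
  rw [map_one]; rfl

open scoped Classical in
/-- Families `x`, `y` with `∑ i, x i * g (y i) = 1` for `g = 1` and `= 0` for all other `g`. -/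
def IsDualSystem (A : GAlgebra G F) {ι : Type*} [Fintype ι] (x y : ι → A.carrier) : Prop :=
  ∀ g : G, ∑ i, x i * A.act g (y i) = if g = 1 then 1 else 0

/-- The sum of the conjugates of `a` under the action of a finite group `H` through `φ`. -/
def traceOf {H : Type*} [Group H] [Fintype H] (A : GAlgebra G F) (φ : H →* G) (a : A.carrier) :
    A.carrier :=
  ∑ h, A.act (φ h) a

theorem act_traceOf {H : Type*} [Group H] [Fintype H] (φ : H →* G) (h : H) (a : A.carrier) :
    A.act (φ h) (A.traceOf φ a) = A.traceOf φ a := by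
  unfold traceOf
  rw [map_sum, ← Equiv.sum_comp (Equiv.mulLeft h) (fun x => A.act (φ x) a)]
  simp

/-- Expanding the trace and exchanging the sums leaves only the term `h = 1`, as `φ` is injective.
-/
theorem IsDualSystem.sum_mul_traceOf {H : Type*} [Group H] [Fintype H] {ι : Type*} [Fintype ι]
    {x y : ι → A.carrier} (hxy : A.IsDualSystem x y) {φ : H →* G} (hφ : Function.Injective φ)
    (a : A.carrier) : ∑ i, x i * A.traceOf φ (y i * a) = a := by
  classical
  simp only [traceOf, Finset.mul_sum, map_mul]
  rw [Finset.sum_comm]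
  simp only [← mul_assoc, ← Finset.sum_mul, hxy _]
  simp [map_eq_one_iff φ hφ]

theorem IsTorsor.exists_isDualSystem (hA : A.IsTorsor) :
    ∃ (ι : Type u) (_ : Fintype ι) (x y : ι → A.carrier), A.IsDualSystem x y := by
  classical
  obtain ⟨t, ht⟩ := hA.bijective.2 (fun g => if g = 1 then 1 else 0)
  obtain ⟨S, rfl⟩ := TensorProduct.exists_finset t
  refine ⟨S, inferInstance, fun i => i.1.1, fun i => i.1.2, fun g => ?_⟩
  have := congrFun ht g
  rw [map_sum, Finset.sum_apply] at this
  rw [Finset.sum_coe_sort S (fun i => i.1 * A.act g i.2)]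
  simpa using this

/-- The invariants of a Galois algebra are the scalars. -/
theorem IsTorsor.exists_algebraMap_eq (hA : A.IsTorsor) {a : A.carrier}
    (ha : ∀ g, A.act g a = a) : ∃ c : F, algebraMap F A.carrier c = a := by
  have := hA.nontrivial
  -- Both tensors go to the constant function `a`. A functional with nonzero value at `1`, applied
  -- to the second factor, turns their equality into a scalar relation between `a` and `1`.
  have h : a ⊗ₜ[F] (1 : A.carrier) = (1 : A.carrier) ⊗ₜ[F] a := by
    apply hA.bijective.1
    funext g
    simp [ha g]
  obtain ⟨f, hf⟩ := Module.Projective.exists_dual_ne_zero F (one_ne_zero (α := A.carrier))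
  have h2 := congrArg (TensorProduct.lid F A.carrier ∘ TensorProduct.comm F A.carrier F ∘
    LinearMap.lTensor A.carrier f) h
  simp at h2
  refine ⟨(f 1)⁻¹ * f a, ?_⟩
  rw [Algebra.algebraMap_eq_smul_one, mul_smul, ← h2, smul_smul, inv_mul_cancel₀ hf, one_smul]

/-- Every `a` is `∑ i, tr (y i * a) • x i` with coefficients in `F`, so the `x i` span. The same
expansion of the second tensor factor shows that the torsor map is injective, and translates of the
dual system give preimages. Both hypotheses are easy to transport along constructions. -/
theorem IsDualSystem.isTorsor [Fintype G] {ι : Type*} [Fintype ι] [Nontrivial A.carrier]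
    {x y : ι → A.carrier} (hxy : A.IsDualSystem x y)
    (htr : ∀ a, ∃ c : F, algebraMap F A.carrier c = A.traceOf (MonoidHom.id G) a) :
    A.IsTorsor := by
  classical
  choose τ hτ using htr
  have key : ∀ a, ∑ i, τ (y i * a) • x i = a := fun a => by
    conv_rhs => rw [← hxy.sum_mul_traceOf (φ := MonoidHom.id G) Function.injective_id a]
    refine Finset.sum_congr rfl fun i _ => ?_
    rw [← hτ, Algebra.smul_def, mul_comm]
  refine ⟨inferInstance, ?_, ?_, ?_⟩
  · refine ⟨⟨Finset.univ.image x, ?_⟩⟩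
    rw [eq_top_iff]
    intro a _
    rw [← key a]
    exact Submodule.sum_mem _ fun i _ => Submodule.smul_mem _ _ (Submodule.subset_span (by simp))
  · rw [injective_iff_map_eq_zero]
    intro t ht
    obtain ⟨S, rfl⟩ := TensorProduct.exists_finset t
    have hz : ∀ g, ∑ s ∈ S, s.1 * A.act g s.2 = 0 := fun g => by
      have := congrFun ht g
      rw [map_sum, Finset.sum_apply] at this
      simpa using this
    have h1 : ∀ s : A.carrier × A.carrier,
        s.1 ⊗ₜ[F] s.2 = ∑ i, (s.1 * A.traceOf (MonoidHom.id G) (y i * s.2)) ⊗ₜ[F] x i := by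
      intro s
      conv_lhs => rw [← key s.2]
      rw [TensorProduct.tmul_sum]
      refine Finset.sum_congr rfl fun i _ => ?_
      rw [← TensorProduct.smul_tmul, ← hτ, Algebra.smul_def, mul_comm]
    rw [Finset.sum_congr rfl fun s _ => h1 s, Finset.sum_comm]
    refine Finset.sum_eq_zero fun i _ => ?_
    rw [← TensorProduct.sum_tmul]
    convert TensorProduct.zero_tmul A.carrier (x i)
    simp only [traceOf, Finset.mul_sum]
    rw [Finset.sum_comm]
    refine Finset.sum_eq_zero fun g _ => ?_
    have := congrArg (A.act g (y i) * ·) (hz g)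
    simp only [Finset.mul_sum, mul_zero] at this
    rw [← this]
    refine Finset.sum_congr rfl fun s _ => ?_
    simp only [MonoidHom.id_apply, map_mul]
    ring
  · intro u
    refine ⟨∑ g, ∑ i, (u g * x i) ⊗ₜ A.act g⁻¹ (y i), ?_⟩
    funext g'
    simp only [map_sum, Finset.sum_apply, torsorMap_tmul, mul_assoc, ← act_mul_apply,
      ← Finset.mul_sum, hxy _]
    simp [mul_inv_eq_one]

theorem IsTorsor.exists_traceOf_eq [Fintype G] (hA : A.IsTorsor) (a : A.carrier) :
    ∃ c : F, algebraMap F A.carrier c = A.traceOf (MonoidHom.id G) a :=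
  hA.exists_algebraMap_eq fun g => act_traceOf (MonoidHom.id G) g a

end Criterion

/-! ### Equivariant maps across groups and base fields -/

section EquivHom

variable {G H J : Type*} [Group G] [Group H] [Group J] {F K L : Type u} [Field F] [Field K] [Field L]

/-- There is a ring homomorphism from `A` to `B` over `ι : F → K` that is equivariant along
`φ : H → G`. -/
def EquivHom (φ : H →* G) (ι : F →+* K) (A : GAlgebra G F) (B : GAlgebra H K) : Prop :=
  ∃ f : A.carrier →+* B.carrier,
    (∀ c, f (algebraMap F A.carrier c) = algebraMap K B.carrier (ι c)) ∧
      ∀ h a, f (A.act (φ h) a) = B.act h (f a)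

theorem EquivHom.comp {φ : H →* G} {ψ : J →* H} {ι : F →+* K} {κ : K →+* L} {A : GAlgebra G F}
    {B : GAlgebra H K} {C : GAlgebra J L} (h₁ : EquivHom φ ι A B) (h₂ : EquivHom ψ κ B C) :
    EquivHom (φ.comp ψ) (κ.comp ι) A C := by
  obtain ⟨f, hf, hf'⟩ := h₁
  obtain ⟨g, hg, hg'⟩ := h₂
  exact ⟨g.comp f, fun c => by simp [hf, hg], fun j a => by simp [hf', hg']⟩

theorem Iso.equivHom {A B : GAlgebra G F} (h : A.Iso B) :
    EquivHom (MonoidHom.id G) (RingHom.id F) A B := by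
  obtain ⟨e, he⟩ := h
  exact ⟨(e : A.carrier →+* B.carrier), fun c => by simp, fun g a => by simpa using he g a⟩

theorem Iso.symm {A B : GAlgebra G F} (h : A.Iso B) : B.Iso A := by
  obtain ⟨e, he⟩ := h
  refine ⟨e.symm, fun g b => ?_⟩
  rw [AlgEquiv.symm_apply_eq, he, AlgEquiv.apply_symm_apply]

theorem Iso.trans {A B C : GAlgebra G F} (h : A.Iso B) (h' : B.Iso C) : A.Iso C := by
  obtain ⟨e, he⟩ := h
  obtain ⟨e', he'⟩ := h'
  exact ⟨e.trans e', fun g b => by simp [he, he']⟩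

/-- An equivariant homomorphism of Galois `G`-algebras is an isomorphism. -/
theorem EquivHom.iso [Finite G] {A B : GAlgebra G F} (hA : A.IsTorsor) (hB : B.IsTorsor)
    (h : EquivHom (MonoidHom.id G) (RingHom.id F) A B) : A.Iso B := by
  classical
  have := Fintype.ofFinite G
  have := hB.nontrivial
  obtain ⟨f, hf, hf'⟩ := h
  obtain ⟨ι, _, x, y, hxy⟩ := hA.exists_isDualSystem
  have htr : ∀ a, f (A.traceOf (MonoidHom.id G) a) = B.traceOf (MonoidHom.id G) (f a) := fun a => by
    rw [traceOf, map_sum]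
    exact Finset.sum_congr rfl fun g _ => hf' g a
  -- The dual system maps to a dual system of the target. Expansions in the two systems have traces,
  -- hence scalars, as coefficients; this gives injectivity and surjectivity.
  have hxy' : B.IsDualSystem (fun i => f (x i)) (fun i => f (y i)) := fun g => by
    have := congrArg f (hxy g)
    rw [map_sum] at this
    simp only [map_mul] at this
    rw [apply_ite f, map_one, map_zero] at this
    rw [← this]
    exact Finset.sum_congr rfl fun i _ => by rw [← hf']; rfl
  refine ⟨AlgEquiv.ofBijective { f with commutes' := hf } ⟨?_, ?_⟩, hf'⟩
  · rw [injective_iff_map_eq_zero]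
    intro a ha
    change f a = 0 at ha
    rw [← hxy.sum_mul_traceOf (φ := MonoidHom.id G) Function.injective_id a]
    refine Finset.sum_eq_zero fun i _ => ?_
    obtain ⟨c, hc⟩ := hA.exists_traceOf_eq (y i * a)
    have h0 : algebraMap F B.carrier c = 0 := by
      have := hf c
      rw [hc, htr, map_mul, ha] at this
      simpa [traceOf] using this.symm
    rw [(map_eq_zero _).1 h0, map_zero] at hc
    rw [← hc, mul_zero]
  · intro b
    have hb := hxy'.sum_mul_traceOf (φ := MonoidHom.id G) Function.injective_id b
    choose τ hτ using hB.exists_traceOf_eq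
    refine ⟨∑ i, x i * algebraMap F A.carrier (τ (f (y i) * b)), ?_⟩
    change f _ = b
    rw [map_sum]
    conv_rhs => rw [← hb]
    refine Finset.sum_congr rfl fun i _ => ?_
    rw [map_mul, hf, ← hτ]; rfl

variable [Algebra F K]

@[elab_as_elim]
theorem baseChange_induction {A : GAlgebra G F} {motive : (A.baseChange K).carrier → Prop}
    (t : (A.baseChange K).carrier) (zero : motive 0) (tmul : ∀ c a, motive (c ⊗ₜ[F] a))
    (add : ∀ a b, motive a → motive b → motive (a + b)) : motive t :=
  TensorProduct.induction_on (motive := motive) t zero tmul add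

theorem equivHom_baseChange (A : GAlgebra G F) (K : Type u) [Field K] [Algebra F K] :
    EquivHom (MonoidHom.id G) (algebraMap F K) A (A.baseChange K) :=
  ⟨((Algebra.TensorProduct.includeRight : A.carrier →ₐ[F] K ⊗[F] A.carrier) :
    A.carrier →+* K ⊗[F] A.carrier), fun c => by
    change (1 : K) ⊗ₜ[F] (algebraMap F A.carrier c) = (algebraMap F K c) ⊗ₜ[F] (1 : A.carrier)
    rw [Algebra.algebraMap_eq_smul_one, Algebra.algebraMap_eq_smul_one, TensorProduct.smul_tmul],
    fun g a => rfl⟩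

theorem EquivHom.lift {φ : H →* G} {A : GAlgebra G F} {B : GAlgebra H K}
    (h : EquivHom φ (algebraMap F K) A B) :
    EquivHom φ (RingHom.id K) (A.baseChange K) B := by
  obtain ⟨f, hf, hf'⟩ := h
  let : Algebra F B.carrier := ((algebraMap K B.carrier).comp (algebraMap F K)).toAlgebra
  have : IsScalarTower F K B.carrier := IsScalarTower.of_algebraMap_eq fun _ => rfl
  let f' : A.carrier →ₐ[F] B.carrier := { f with commutes' := hf }
  let Φ : K ⊗[F] A.carrier →ₐ[K] B.carrier :=
    Algebra.TensorProduct.lift (Algebra.ofId K B.carrier) f' (fun _ _ => Commute.all _ _)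
  let Ψ : (A.baseChange K).carrier →+* B.carrier := (Φ : K ⊗[F] A.carrier →+* B.carrier)
  refine ⟨Ψ, fun c => Φ.commutes c, fun g t => ?_⟩
  induction t using baseChange_induction with
  | zero => simp only [map_zero]
  | add a b ha hb => simp only [map_add, ha, hb]
  | tmul c a =>
    change Φ (c ⊗ₜ[F] A.act (φ g) a) = B.act g (Φ (c ⊗ₜ[F] a))
    simp [Φ, f', Algebra.ofId_apply, hf']

theorem IsTorsor.baseChange [Finite G] {A : GAlgebra G F} (hA : A.IsTorsor) (K : Type u) [Field K]
    [Algebra F K] : (A.baseChange K).IsTorsor := by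
  classical
  have := Fintype.ofFinite G
  have := hA.nontrivial
  obtain ⟨ι, _, x, y, hxy⟩ := hA.exists_isDualSystem
  have : Nontrivial (A.baseChange K).carrier :=
    inferInstanceAs (Nontrivial (K ⊗[F] A.carrier))
  have : (A.baseChange K).IsDualSystem (fun i => (1 : K) ⊗ₜ[F] x i)
      (fun i => (1 : K) ⊗ₜ[F] y i) := fun g => by
    change ∑ i, ((1 : K) ⊗ₜ[F] x i) * ((1 : K) ⊗ₜ[F] A.act g (y i)) = _
    simp only [Algebra.TensorProduct.tmul_mul_tmul, one_mul, ← TensorProduct.tmul_sum, hxy g]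
    split_ifs
    · rfl
    · exact TensorProduct.tmul_zero _ _
  refine this.isTorsor fun t => ?_
  unfold traceOf
  induction t using baseChange_induction with
  | zero => exact ⟨0, by simp⟩
  | add a b ha hb =>
    obtain ⟨c, hc⟩ := ha
    obtain ⟨d, hd⟩ := hb
    exact ⟨c + d, by simp only [map_add, hc, hd, Finset.sum_add_distrib]⟩
  | tmul c a =>
    obtain ⟨d, hd⟩ := hA.exists_traceOf_eq a
    refine ⟨c * algebraMap F K d, ?_⟩
    simp only [MonoidHom.id_apply]
    change (c * algebraMap F K d) ⊗ₜ[F] (1 : A.carrier) = ∑ g, c ⊗ₜ[F] A.act g a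
    rw [← TensorProduct.tmul_sum]
    change _ = c ⊗ₜ[F] (A.traceOf (MonoidHom.id G) a)
    rw [← hd, Algebra.algebraMap_eq_smul_one (A := A.carrier), ← TensorProduct.smul_tmul,
      Algebra.smul_def, mul_comm]

end EquivHom

end GAlgebra

/-! ### Induction of torsors from a subgroup -/

theorem mk_mul_map_eq {G H : Type*} [Group G] [Group H] (φ : H →* G) (g : G) (h : H) :
    (QuotientGroup.mk (g * φ h) : G ⧸ φ.range) = QuotientGroup.mk g :=
  QuotientGroup.mk_mul_of_mem g ⟨h, rfl⟩

theorem exists_mul_map_eq_out {G H : Type*} [Group G] [Group H] (φ : H →* G) (g : G) :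
    ∃ h, g * φ h = (QuotientGroup.mk g : G ⧸ φ.range).out := by
  obtain ⟨⟨x, h, rfl⟩, hx⟩ := QuotientGroup.mk_out_eq_mul φ.range g
  exact ⟨h, hx.symm⟩

namespace GAlgebra

section Induced

variable {G : Type} {H : Type*} [Group G] [Group H] {F : Type u} [Field F]

/-- The functions `f : G → B` with `f (g * φ h) = h⁻¹ (f g)`. -/
def inducedSubalgebra (φ : H →* G) (B : GAlgebra H F) : Subalgebra F (G → B.carrier) where
  carrier := {f | ∀ g h, f (g * φ h) = B.act h⁻¹ (f g)}
  mul_mem' ha hb g h := by simp only [Pi.mul_apply, ha g h, hb g h, map_mul]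
  add_mem' ha hb g h := by simp only [Pi.add_apply, ha g h, hb g h, map_add]
  algebraMap_mem' c g h := by simp

/-- The action of `g` on functions by `x ↦ f (g⁻¹ * x)`. -/
def inducedAct (φ : H →* G) (B : GAlgebra H F) (g : G) :
    inducedSubalgebra φ B →ₐ[F] inducedSubalgebra φ B where
  toFun f := ⟨fun x => f.1 (g⁻¹ * x), fun x h => by
    simpa only [mul_assoc] using f.2 (g⁻¹ * x) h⟩
  map_one' := rfl
  map_mul' _ _ := rfl
  map_zero' := rfl
  map_add' _ _ := rfl
  commutes' _ := rfl

@[simp]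
theorem inducedAct_apply (φ : H →* G) (B : GAlgebra H F) (g : G) (f : inducedSubalgebra φ B)
    (x : G) : (inducedAct φ B g f).1 x = f.1 (g⁻¹ * x) := rfl

/-- The `G`-algebra induced along `φ : H → G` from an `H`-algebra. -/
def induced (φ : H →* G) (B : GAlgebra H F) : GAlgebra G F where
  carrier := inducedSubalgebra φ B
  act :=
    { toFun := fun g => AlgEquiv.ofAlgHom (inducedAct φ B g) (inducedAct φ B g⁻¹)
        (by ext f x; simp) (by ext f x; simp)
      map_one' := by ext f x; simp
      map_mul' := fun g g' => by ext f x; simp [mul_assoc] }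

variable {φ : H →* G} {B : GAlgebra H F}

/-- Evaluation at a point of `G`. -/
def inducedEval (φ : H →* G) (B : GAlgebra H F) (x : G) : (induced φ B).carrier →ₐ[F] B.carrier :=
  (Pi.evalAlgHom F (fun _ : G => B.carrier) x).comp (inducedSubalgebra φ B).val

theorem inducedEval_act (g : G) (f : (induced φ B).carrier) (x : G) :
    inducedEval φ B x ((induced φ B).act g f) = inducedEval φ B (g⁻¹ * x) f := rfl

theorem inducedEval_mul (f : (induced φ B).carrier) (x : G) (h : H) :
    inducedEval φ B (x * φ h) f = B.act h⁻¹ (inducedEval φ B x f) := f.2 x h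

theorem induced_ext {f f' : (induced φ B).carrier}
    (h : ∀ x, inducedEval φ B x f = inducedEval φ B x f') : f = f' :=
  Subtype.ext (funext h)

theorem equivHom_induced (φ : H →* G) (B : GAlgebra H F) :
    EquivHom φ (RingHom.id F) (induced φ B) B :=
  ⟨(inducedEval φ B 1 : (induced φ B).carrier →+* B.carrier), fun c => by simp, fun h f => by
    have := inducedEval_mul f 1 h⁻¹
    simpa [inducedEval_act] using this⟩

/-- Frobenius reciprocity: `a ↦ (g ↦ f (g⁻¹ a))` is adjoint to evaluation at `1`. -/
theorem EquivHom.toInduced {A : GAlgebra G F} (hAB : EquivHom φ (RingHom.id F) A B) :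
    EquivHom (MonoidHom.id G) (RingHom.id F) A (induced φ B) := by
  obtain ⟨f, hf, hf'⟩ := hAB
  let Φ : A.carrier →+* (induced φ B).carrier := RingHom.codRestrict
    (RingHom.pi fun g : G => f.comp ((A.act g⁻¹ : A.carrier ≃ₐ[F] A.carrier) :
      A.carrier →+* A.carrier)) (inducedSubalgebra φ B) fun a g h => by
        change f (A.act (g * φ h)⁻¹ a) = B.act h⁻¹ (f (A.act g⁻¹ a))
        rw [← hf', mul_inv_rev, act_mul_apply, map_inv φ]
  refine ⟨Φ, fun c => ?_, fun g a => ?_⟩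
  · apply Subtype.ext
    funext g
    change f (A.act g⁻¹ (algebraMap F A.carrier c)) = algebraMap F B.carrier c
    rw [AlgEquiv.commutes, hf]; rfl
  · apply Subtype.ext
    funext x
    change f (A.act x⁻¹ (A.act g a)) = f (A.act (g⁻¹ * x)⁻¹ a)
    simp

/-- The equivariance of `η` is what makes `g ↦ η g • z` an element of the induced algebra. -/
theorem exists_coset_translation (φ : H →* G) (hφ : Function.Injective φ) :
    ∃ η : G → H, (∀ g h, η (g * φ h) = h⁻¹ * η g) ∧
      ∀ g, g * φ (η g) = (QuotientGroup.mk g : G ⧸ φ.range).out := by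
  choose η hη using exists_mul_map_eq_out φ
  refine ⟨η, fun g h => hφ ?_, hη⟩
  have h1 := hη (g * φ h)
  rw [mk_mul_map_eq, ← hη g] at h1
  rw [map_mul, map_inv, eq_inv_mul_iff_mul_eq]
  exact mul_left_cancel (by rw [← mul_assoc, h1])

theorem IsTorsor.induced [Finite G] [Finite H] (hφ : Function.Injective φ) (hB : B.IsTorsor) :
    (induced φ B).IsTorsor := by
  classical
  have := Fintype.ofFinite G
  have := Fintype.ofFinite H
  have := hB.nontrivial
  obtain ⟨ι, _, x, y, hxy⟩ := hB.exists_isDualSystem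
  obtain ⟨η, hη, hη'⟩ := exists_coset_translation φ hφ
  -- `e z c` spreads `z` over the coset `c` and vanishes elsewhere. Spreading the dual system of `B`
  -- over every coset gives one for the induced algebra.
  let e (z : B.carrier) (c : G ⧸ φ.range) : (GAlgebra.induced φ B).carrier :=
    ⟨fun g => if (g : G ⧸ φ.range) = c then B.act (η g) z else 0, fun g h => by
      simp only [mk_mul_map_eq, hη, act_mul_apply]
      split_ifs <;> simp⟩
  have : Nontrivial (GAlgebra.induced φ B).carrier :=
    inferInstanceAs (Nontrivial (inducedSubalgebra φ B))
  have hds : (GAlgebra.induced φ B).IsDualSystem (fun i : ι × (G ⧸ φ.range) => e (x i.1) i.2)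
      (fun i => e (y i.1) i.2) := fun g => by
    refine induced_ext fun a => ?_
    trans ∑ i : ι × (G ⧸ φ.range), (if (a : G ⧸ φ.range) = i.2 then B.act (η a) (x i.1) else 0) *
        (if ((g⁻¹ * a : G) : G ⧸ φ.range) = i.2 then B.act (η (g⁻¹ * a)) (y i.1) else 0)
    · rw [map_sum]
      rfl
    · rw [Fintype.sum_prod_type, Finset.sum_congr rfl (fun i _ => Finset.sum_eq_single
        (a : G ⧸ φ.range) (fun c _ hc => by rw [if_neg (Ne.symm hc), zero_mul]) (by simp))]
      simp only [if_true]
      by_cases hg : ((g⁻¹ * a : G) : G ⧸ φ.range) = a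
      · simp only [hg, if_true]
        have h1 := hη' (g⁻¹ * a)
        rw [hg, ← hη' a] at h1
        have h2 : ∀ i, B.act (η a) (x i) * B.act (η (g⁻¹ * a)) (y i) =
            B.act (η a) (x i * B.act ((η a)⁻¹ * η (g⁻¹ * a)) (y i)) := fun i => by
          rw [map_mul, ← act_mul_apply, mul_inv_cancel_left]
        simp only [h2, ← map_sum, hxy _]
        by_cases hg1 : g = 1
        · subst hg1; simp
        · rw [if_neg, if_neg hg1, map_zero]
          · rfl
          · intro h3
            rw [← inv_mul_eq_one.1 h3] at h1
            have := mul_right_cancel (mul_right_cancel h1 |>.trans (one_mul a).symm)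
            exact hg1 (by simpa using this)
      · have hg1 : g ≠ 1 := by rintro rfl; simp at hg
        simp only [hg, if_false, mul_zero, Finset.sum_const_zero, if_neg hg1]
        rfl
  refine hds.isTorsor fun f => ?_
  obtain ⟨c, hc⟩ := hB.exists_traceOf_eq (∑ r : G ⧸ φ.range, inducedEval φ B r.out f)
  refine ⟨c, induced_ext fun a => ?_⟩
  rw [AlgHom.commutes, hc, traceOf, traceOf, map_sum]
  change _ = ∑ g : G, inducedEval φ B (((Equiv.inv G).trans (Equiv.mulRight a)) g) f
  rw [Equiv.sum_comp ((Equiv.inv G).trans (Equiv.mulRight a)) (fun g => inducedEval φ B g f)]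
  simp only [map_sum, MonoidHom.id_apply]
  rw [← Fintype.sum_prod_type' (f := fun h (r : G ⧸ φ.range) => B.act h (inducedEval φ B r.out f))]
  -- Each element of `G` is uniquely a coset representative times some `φ h⁻¹`, so the `G`-trace is
  -- a sum of `H`-traces.
  refine Fintype.sum_bijective (fun i : H × (G ⧸ φ.range) => i.2.out * φ i.1⁻¹) ⟨?_, ?_⟩ _ _ ?_
  · rintro ⟨h, r⟩ ⟨h', r'⟩ hh
    simp only at hh
    have h3 := congrArg (QuotientGroup.mk (s := φ.range)) hh
    rw [mk_mul_map_eq, mk_mul_map_eq, QuotientGroup.out_eq', QuotientGroup.out_eq'] at h3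
    subst h3
    rw [inv_injective (hφ (mul_left_cancel hh))]
  · intro g
    exact ⟨(η g, (g : G ⧸ φ.range)), by simp [← hη']⟩
  · rintro ⟨h, r⟩
    rw [inducedEval_mul, inv_inv]

/-- Hence two `G`-torsors with equivariant maps to the same `H`-torsor are isomorphic. -/
theorem EquivHom.iso_induced [Finite G] [Finite H] {A : GAlgebra G F} (hφ : Function.Injective φ)
    (hA : A.IsTorsor) (hB : B.IsTorsor) (hAB : EquivHom φ (RingHom.id F) A B) :
    A.Iso (GAlgebra.induced φ B) :=
  hAB.toInduced.iso hA (hB.induced hφ)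

end Induced

end GAlgebra

/-- A finite algebra of dimension prime to `l` has a residue field of degree prime to `l`. -/
theorem exists_isMaximal_not_dvd_finrank {F : Type*} {C : Type u} [Field F] [CommRing C]
    [Algebra F C] [Module.Finite F C] {l : ℕ} (hl : ¬ l ∣ Module.finrank F C) :
    ∃ m : Ideal C, m.IsMaximal ∧ ¬ l ∣ Module.finrank F (C ⧸ m) := by
  by_contra! hcon
  have : IsArtinianRing C := IsArtinianRing.of_finite F C
  -- `C` has a filtration with subquotients `C ⧸ p`, where `p` is maximal because `C` is Artinian.
  -- Dimension is additive, so `l` would divide that of `C`.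
  refine hl (IsNoetherianRing.induction_on_isQuotientEquivQuotientPrime C
    (inferInstance : Module.Finite C C)
    (motive := fun N _ _ _ => ∀ (_ : Module F N), IsScalarTower F C N → l ∣ Module.finrank F N)
    ?_ ?_ ?_ inferInstance inferInstance)
  · intro N _ _ _ _ _ _
    rw [Module.finrank_zero_of_subsingleton]
    exact dvd_zero l
  · intro N _ _ _ p e _ _
    rw [(e.restrictScalars F).finrank_eq]
    exact hcon p.asIdeal inferInstance
  · intro N₁ _ _ _ N₂ _ _ _ N₃ _ _ _ f g hf hg hfg h₁ h₃ _ _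
    let : Module F N₁ := Module.compHom N₁ (algebraMap F C)
    let : Module F N₃ := Module.compHom N₃ (algebraMap F C)
    have t₁ : IsScalarTower F C N₁ := ⟨fun a b x => by
      rw [Algebra.smul_def, mul_smul]; rfl⟩
    have t₃ : IsScalarTower F C N₃ := ⟨fun a b x => by
      rw [Algebra.smul_def, mul_smul]; rfl⟩
    have : Module.Finite F N₂ := Module.Finite.trans C N₂
    let f' := f.restrictScalars F
    let g' := g.restrictScalars F
    have hker : LinearMap.ker g' = LinearMap.range f' := by
      ext x
      exact hfg x
    rw [← LinearMap.finrank_range_add_finrank_ker g', (LinearMap.range_eq_top (f := g')).2 hg, finrank_top,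
      hker, LinearMap.finrank_range_of_inj (f := f') hf]
    exact dvd_add (h₃ _ t₃) (h₁ _ t₁)

namespace GAlgebra

/-! ### The invariants of a subgroup -/

section Fixed

variable {G H : Type*} [Group G] [Group H] {F : Type u} [Field F]

/-- The invariants under the action of `H` through `φ : H → G`. -/
def fixedSubalgebra (A : GAlgebra G F) (φ : H →* G) : Subalgebra F A.carrier where
  carrier := {a | ∀ h, A.act (φ h) a = a}
  mul_mem' ha hb h := by rw [map_mul, ha h, hb h]
  add_mem' ha hb h := by rw [map_add, ha h, hb h]
  algebraMap_mem' c h := by rw [AlgEquiv.commutes]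

variable {A : GAlgebra G F} {φ : H →* G}

/-- The torsor map carries `A ⊗ A^H` onto the functions `G → A` that are constant on cosets of `H`.
Comparing dimensions over `F` gives the index. -/
theorem finrank_fixedSubalgebra [Finite G] [Finite H] (hφ : Function.Injective φ)
    (hA : A.IsTorsor) : Module.finrank F (A.fixedSubalgebra φ) = φ.range.index := by
  classical
  have := Fintype.ofFinite G
  have := Fintype.ofFinite H
  have := hA.nontrivial
  have := hA.finite
  let inc : A.carrier ⊗[F] A.fixedSubalgebra φ →ₗ[F] A.carrier ⊗[F] A.carrier :=
    LinearMap.lTensor A.carrier (A.fixedSubalgebra φ).val.toLinearMap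
  have hinc : Function.Injective inc :=
    Module.Flat.lTensor_preserves_injective_linearMap _ Subtype.val_injective
  let Θ : A.carrier ⊗[F] A.fixedSubalgebra φ →ₗ[F] (G ⧸ φ.range → A.carrier) :=
    LinearMap.funLeft F A.carrier Quotient.out ∘ₗ A.torsorMap.toLinearMap ∘ₗ inc
  have hinv : ∀ t g h, A.torsorMap (inc t) (g * φ h) = A.torsorMap (inc t) g := by
    intro t g h
    induction t using TensorProduct.induction_on with
    | zero => simp
    | add a b ha hb => simp only [map_add, Pi.add_apply, ha, hb]
    | tmul a c =>
      change A.torsorMap (a ⊗ₜ c.1) _ = A.torsorMap (a ⊗ₜ c.1) _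
      rw [torsorMap_tmul, torsorMap_tmul, act_mul_apply, c.2 h]
  have hΘ : Function.Bijective Θ := by
    constructor
    · rw [injective_iff_map_eq_zero]
      intro t ht
      apply hinc
      apply hA.bijective.1
      rw [map_zero, map_zero]
      funext g
      obtain ⟨h, hh⟩ := exists_mul_map_eq_out φ g
      rw [← hinv t g h, hh]
      exact congrFun ht (g : G ⧸ φ.range)
    · intro w
      obtain ⟨ι, _, x, y, hxy⟩ := hA.exists_isDualSystem
      -- The `H`-trace makes the translates of the `y i` invariant, and pairing with the `x i`
      -- isolates the coset `r`.
      refine ⟨∑ r : G ⧸ φ.range, ∑ i, (w r * x i) ⊗ₜ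
        ⟨A.traceOf φ (A.act r.out⁻¹ (y i)), fun h => act_traceOf φ h _⟩, ?_⟩
      funext c
      simp only [map_sum, Finset.sum_apply]
      change ∑ r : G ⧸ φ.range, ∑ i, A.torsorMap ((w r * x i) ⊗ₜ
        (A.traceOf φ (A.act r.out⁻¹ (y i)))) c.out = w c
      have hsum : ∀ r : G ⧸ φ.range, ∑ i, A.torsorMap ((w r * x i) ⊗ₜ
          (A.traceOf φ (A.act r.out⁻¹ (y i)))) c.out =
            ∑ h, w r * if c.out * φ h * r.out⁻¹ = 1 then 1 else 0 := fun r => by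
        simp only [torsorMap_tmul, traceOf, map_sum, ← act_mul_apply, Finset.mul_sum, mul_assoc]
        rw [Finset.sum_comm]
        refine Finset.sum_congr rfl fun h _ => ?_
        rw [← Finset.mul_sum, hxy]
      simp only [hsum]
      rw [Finset.sum_eq_single c]
      · rw [Finset.sum_eq_single 1]
        · simp
        · intro h _ hh
          rw [if_neg, mul_zero]
          rw [mul_inv_eq_one, mul_eq_left, map_eq_one_iff φ hφ]
          exact hh
        · simp
      · intro r _ hr
        refine Finset.sum_eq_zero fun h _ => ?_
        rw [if_neg, mul_zero]
        rw [mul_inv_eq_one]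
        intro hh
        apply hr
        rw [← QuotientGroup.out_eq' r, ← hh, mk_mul_map_eq,
          QuotientGroup.out_eq']
      · simp
  have := (LinearEquiv.ofBijective Θ hΘ).finrank_eq
  rw [Module.finrank_tensorProduct, Module.finrank_pi_fintype] at this
  simp only [Finset.sum_const, Finset.card_univ, smul_eq_mul] at this
  rw [mul_comm] at this
  rw [Nat.eq_of_mul_eq_mul_right Module.finrank_pos this, Subgroup.index, Nat.card_eq_fintype_card]

end Fixed

/-! ### Reduction of the structure group to a subgroup -/

section Reduction

variable {G H : Type*} [Group G] [Group H] {F : Type u} [Field F]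

/-- The action of `H` by automorphisms over its invariants. -/
def fixedAct (A : GAlgebra G F) (φ : H →* G) :
    H →* (A.carrier ≃ₐ[A.fixedSubalgebra φ] A.carrier) where
  toFun h := { (A.act (φ h) : A.carrier ≃+* A.carrier) with
    commutes' := fun c => c.2 h }
  map_one' := by ext a; exact congrArg (fun g => A.act g a) (map_one φ) |>.trans (A.act_one_apply a)
  map_mul' h h' := by
    ext a
    exact congrArg (fun g => A.act g a) (map_mul φ h h') |>.trans (A.act_mul_apply _ _ a)

@[simp]
theorem fixedAct_apply (A : GAlgebra G F) (φ : H →* G) (h : H) (a : A.carrier) :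
    A.fixedAct φ h a = A.act (φ h) a := rfl

/-- The fibre of a `G`-algebra over a `K`-point of the quotient of its spectrum by `H`, as an
`H`-algebra over `K`. -/
def reduction (A : GAlgebra G F) (φ : H →* G) (K : Type u) [Field K]
    [Algebra (A.fixedSubalgebra φ) K] : GAlgebra H K where
  carrier := K ⊗[A.fixedSubalgebra φ] A.carrier
  act :=
    { toFun := fun h => Algebra.TensorProduct.congr AlgEquiv.refl (A.fixedAct φ h)
      map_one' := by
        ext x
        induction x using TensorProduct.induction_on with
        | zero => simp
        | tmul a b => simp
        | add a b ha hb => simp only [map_add, ha, hb]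
      map_mul' := by
        intro g h
        ext x
        induction x using TensorProduct.induction_on with
        | zero => simp
        | tmul a b => simp
        | add a b ha hb => simp only [map_add, ha, hb] }

variable {A : GAlgebra G F} {φ : H →* G} {K : Type u} [Field K] [Algebra (A.fixedSubalgebra φ) K]

@[elab_as_elim]
theorem reduction_induction {motive : (A.reduction φ K).carrier → Prop}
    (t : (A.reduction φ K).carrier) (zero : motive 0)
    (tmul : ∀ c a, motive (c ⊗ₜ[A.fixedSubalgebra φ] a))
    (add : ∀ a b, motive a → motive b → motive (a + b)) : motive t :=
  TensorProduct.induction_on (motive := motive) t zero tmul add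

theorem fixed_tmul (c : A.fixedSubalgebra φ) :
    (1 : K) ⊗ₜ[A.fixedSubalgebra φ] (c : A.carrier) =
      (algebraMap (A.fixedSubalgebra φ) K c) ⊗ₜ[A.fixedSubalgebra φ] (1 : A.carrier) := by
  rw [Algebra.algebraMap_eq_smul_one, TensorProduct.smul_tmul, Algebra.smul_def, mul_one]
  rfl

theorem equivHom_reduction {ι : F →+* K}
    (hι : ∀ c, algebraMap (A.fixedSubalgebra φ) K (algebraMap F _ c) = ι c) :
    EquivHom φ ι A (A.reduction φ K) :=
  ⟨((Algebra.TensorProduct.includeRight : A.carrier →ₐ[A.fixedSubalgebra φ]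
    K ⊗[A.fixedSubalgebra φ] A.carrier) : A.carrier →+* K ⊗[A.fixedSubalgebra φ] A.carrier),
    fun c => by
      rw [← hι]
      exact fixed_tmul (algebraMap F (A.fixedSubalgebra φ) c), fun h a => rfl⟩

theorem EquivHom.of_reduction {L : Type u} [Field L] {B : GAlgebra H L} {κ : K →+* L}
    (f : A.carrier →+* B.carrier)
    (hf : ∀ c : A.fixedSubalgebra φ, f c = algebraMap L B.carrier (κ (algebraMap _ K c)))
    (hf' : ∀ h a, f (A.act (φ h) a) = B.act h (f a)) :
    EquivHom (MonoidHom.id H) κ (A.reduction φ K) B := by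
  let : Algebra (A.fixedSubalgebra φ) B.carrier :=
    (f.comp (A.fixedSubalgebra φ).val.toRingHom).toAlgebra
  let f₁ : K →ₐ[A.fixedSubalgebra φ] B.carrier :=
    { (algebraMap L B.carrier).comp κ with commutes' := fun c => (hf c).symm }
  let f₂ : A.carrier →ₐ[A.fixedSubalgebra φ] B.carrier := { f with commutes' := fun c => rfl }
  let Φ := Algebra.TensorProduct.lift f₁ f₂ (fun _ _ => Commute.all _ _)
  let Ψ : (A.reduction φ K).carrier →+* B.carrier :=
    (Φ : K ⊗[A.fixedSubalgebra φ] A.carrier →+* B.carrier)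
  have hΨ : ∀ c a, Ψ (c ⊗ₜ[A.fixedSubalgebra φ] a) = algebraMap L B.carrier (κ c) * f a :=
    fun c a => Algebra.TensorProduct.lift_tmul f₁ f₂ (fun _ _ => Commute.all _ _) c a
  refine ⟨Ψ, fun c => ?_, fun h t => ?_⟩
  · exact (hΨ c 1).trans (by rw [map_one, mul_one])
  · induction t using reduction_induction with
    | zero => simp only [map_zero]
    | add a b ha hb => simp only [map_add, ha, hb]
    | tmul c a =>
      change Ψ (c ⊗ₜ[A.fixedSubalgebra φ] A.act (φ h) a) = _
      rw [hΨ, hΨ, map_mul, hf', AlgEquiv.commutes]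

/-- The trace as a linear map over the invariants. -/
def fixedTrace [Fintype H] (A : GAlgebra G F) (φ : H →* G) :
    A.carrier →ₗ[A.fixedSubalgebra φ] A.fixedSubalgebra φ where
  toFun a := ⟨A.traceOf φ a, fun h => act_traceOf φ h a⟩
  map_add' a b := Subtype.ext (by simp [traceOf, Finset.sum_add_distrib])
  map_smul' c a := Subtype.ext (by
    simp only [traceOf, Algebra.smul_def, map_mul, RingHom.id_apply]
    change ∑ h, A.act (φ h) c.1 * _ = c.1 * _
    rw [Finset.mul_sum]
    exact Finset.sum_congr rfl fun h _ => by rw [c.2 h])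

/-- By integrality some prime `Q` of `A` lies over the kernel of `A^H → K`. If all traces lay in
this kernel, then `1 = ∑ i, x i * tr (y i)` would lie in `Q`. This is what makes the fibre `K ⊗ A`
nonzero. -/
theorem IsTorsor.exists_fixedTrace_ne_zero [Fintype H] (hφ : Function.Injective φ)
    (hA : A.IsTorsor) : ∃ a, algebraMap (A.fixedSubalgebra φ) K (A.fixedTrace φ a) ≠ 0 := by
  by_contra! h
  have := hA.nontrivial
  have := hA.finite
  obtain ⟨ι, _, x, y, hxy⟩ := hA.exists_isDualSystem
  have : Algebra.IsIntegral (A.fixedSubalgebra φ) A.carrier := Algebra.IsIntegral.tower_top (R := F)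
  have := RingHom.ker_isPrime (algebraMap (A.fixedSubalgebra φ) K)
  obtain ⟨Q, -, hQ, hQ'⟩ := Ideal.exists_ideal_over_prime_of_isIntegral (S := A.carrier)
    (RingHom.ker (algebraMap (A.fixedSubalgebra φ) K)) ⊥ (by
      rw [Ideal.comap_bot_of_injective _ Subtype.val_injective]
      exact bot_le)
  apply hQ.ne_top
  rw [Ideal.eq_top_iff_one, ← hxy.sum_mul_traceOf hφ 1]
  refine Ideal.sum_mem _ fun i _ => Ideal.mul_mem_left _ _ ?_
  have h1 : A.fixedTrace φ (y i * 1) ∈ RingHom.ker (algebraMap (A.fixedSubalgebra φ) K) := h _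
  rw [← hQ'] at h1
  exact h1

theorem IsTorsor.reduction [Finite H] (hφ : Function.Injective φ) (hA : A.IsTorsor) (K : Type u)
    [Field K] [Algebra (A.fixedSubalgebra φ) K] : (A.reduction φ K).IsTorsor := by
  classical
  have := Fintype.ofFinite H
  obtain ⟨ι, _, x, y, hxy⟩ := hA.exists_isDualSystem
  have : Nontrivial (A.reduction φ K).carrier := by
    obtain ⟨a, ha⟩ := hA.exists_fixedTrace_ne_zero (K := K) hφ
    by_contra hn
    rw [not_nontrivial_iff_subsingleton] at hn
    apply ha
    have h0 : (1 : K) ⊗ₜ[A.fixedSubalgebra φ] a = 0 :=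
      @Subsingleton.elim (A.reduction φ K).carrier hn _ _
    have := congrArg ((TensorProduct.rid (A.fixedSubalgebra φ) K) ∘
      LinearMap.lTensor K (A.fixedTrace φ)) h0
    simpa [Algebra.smul_def] using this
  have hds : (A.reduction φ K).IsDualSystem (fun i => (1 : K) ⊗ₜ[A.fixedSubalgebra φ] x i)
      (fun i => (1 : K) ⊗ₜ[A.fixedSubalgebra φ] y i) := fun h => by
    change ∑ i, ((1 : K) ⊗ₜ[A.fixedSubalgebra φ] x i) *
      ((1 : K) ⊗ₜ[A.fixedSubalgebra φ] A.act (φ h) (y i)) = _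
    simp only [Algebra.TensorProduct.tmul_mul_tmul, one_mul, ← TensorProduct.tmul_sum, hxy (φ h),
      map_eq_one_iff φ hφ]
    split_ifs
    · rfl
    · exact TensorProduct.tmul_zero _ _
  refine hds.isTorsor fun t => ?_
  unfold traceOf
  induction t using reduction_induction with
  | zero => exact ⟨0, by simp⟩
  | add a b ha hb =>
    obtain ⟨c, hc⟩ := ha
    obtain ⟨d, hd⟩ := hb
    exact ⟨c + d, by simp only [map_add, hc, hd, Finset.sum_add_distrib]⟩
  | tmul c a =>
    refine ⟨c * algebraMap _ K (A.fixedTrace φ a), ?_⟩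
    change (c * algebraMap _ K (A.fixedTrace φ a)) ⊗ₜ[A.fixedSubalgebra φ] (1 : A.carrier) =
      ∑ h, c ⊗ₜ[A.fixedSubalgebra φ] A.act (φ h) a
    rw [← TensorProduct.tmul_sum]
    change _ = c ⊗ₜ[A.fixedSubalgebra φ] ((A.fixedTrace φ a : A.fixedSubalgebra φ) : A.carrier)
    rw [mul_comm, ← Algebra.smul_def, TensorProduct.smul_tmul, Algebra.smul_def, mul_one]
    rfl

end Reduction

end GAlgebra

/-! ### Comparison of essential dimensions -/

open Algebra in
theorem trdeg_eq_of_isAlgebraic (k : Type*) (E E' : Type u) [Field k] [Field E] [Field E']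
    [Algebra k E] [Algebra k E'] [Algebra E E'] [IsScalarTower k E E'] [Algebra.IsAlgebraic E E'] :
    Algebra.trdeg k E' = Algebra.trdeg k E := by
  rw [← trdeg_add_eq k E (A := E'), trdeg_eq_zero (R := E), add_zero]

namespace GAlgebra

section EssentialDimension

variable {G : Type} {H : Type*} [Group G] [Group H] {φ : H →* G} {k F : Type u} [Field k] [Field F]
  [Algebra k F]

/-- If `B` descends over `L` to `B₀` over `E`, then over `L` both `A` and `induced φ B₀` are induced
from the base change of `B₀`. So every descent of `B` gives one of `A` to the same field. -/
theorem EquivHom.essDimAt_le [Finite G] [Finite H] {F' : Type u} [Field F'] [Algebra k F']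
    [Algebra F F'] [IsScalarTower k F F'] [FiniteDimensional F F'] {l : ℕ} (hl : l.Prime)
    (hdeg : ¬ l ∣ Module.finrank F F') (hφ : Function.Injective φ) {A : GAlgebra G F}
    {B : GAlgebra H F'} (hA : A.IsTorsor)
    (hAB : EquivHom φ (algebraMap F F') A B) : A.essDimAt k l ≤ B.essDimAt k l := by
  unfold essDimAt
  refine le_iInf fun L => le_iInf fun _ => le_iInf fun _ => le_iInf fun _ => le_iInf fun _ =>
    le_iInf fun _ => le_iInf fun hL => ?_
  let : Algebra F L := ((algebraMap F' L).comp (algebraMap F F')).toAlgebra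
  have : IsScalarTower F F' L := IsScalarTower.of_algebraMap_eq fun _ => rfl
  have : IsScalarTower k F L := IsScalarTower.of_algebraMap_eq fun c => by
    rw [IsScalarTower.algebraMap_apply k F' L, IsScalarTower.algebraMap_apply k F F',
      IsScalarTower.algebraMap_apply F F' L]
  have hfin : FiniteDimensional F L := FiniteDimensional.trans F F' L
  have hL' : ¬ l ∣ Module.finrank F L := by
    rw [← Module.finrank_mul_finrank F F' L, hl.dvd_mul]
    tauto
  refine iInf_le_of_le L <| iInf_le_of_le inferInstance <| iInf_le_of_le inferInstance <|
    iInf_le_of_le inferInstance <| iInf_le_of_le inferInstance <| iInf_le_of_le hfin <|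
    iInf_le_of_le hL' ?_
  refine le_iInf fun E => le_iInf fun B₀ => le_iInf fun hB₀ => le_iInf fun hiso => ?_
  refine iInf_le_of_le E <| iInf_le_of_le (induced φ B₀) <| iInf_le_of_le (hB₀.induced hφ) <|
    iInf_le_of_le ?_ le_rfl
  have hBL := hB₀.baseChange L
  have h₁ : EquivHom φ (algebraMap F L) A (B₀.baseChange L) :=
    (hAB.comp (equivHom_baseChange B L)).comp hiso.symm.equivHom
  have h₂ : EquivHom φ (algebraMap E L) (induced φ B₀) (B₀.baseChange L) :=
    (equivHom_induced φ B₀).comp (equivHom_baseChange B₀ L)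
  exact (h₂.lift.iso_induced hφ ((hB₀.induced hφ).baseChange L) hBL).trans
    (h₁.lift.iso_induced hφ (hA.baseChange L) hBL).symm

theorem trdeg_restrictScalars_eq (E : IntermediateField k F) (E' : IntermediateField E F)
    [Algebra.IsAlgebraic E E'] :
    Algebra.trdeg k (E'.restrictScalars k) = Algebra.trdeg k E := by
  have : IsScalarTower k E E' := inferInstance
  exact trdeg_eq_of_isAlgebraic k E E'

/-- The `H`-invariants of `B` are the scalars, so `A^H` maps to `F` over `E`. Adjoining the image
gives `E'`, algebraic over `E`, and the fibre of `A` over this `E'`-point becomes `B` over `F`. -/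
theorem essDim_le_of_equivHom [Finite G] [Finite H] (hφ : Function.Injective φ)
    {B : GAlgebra H F} (hB : B.IsTorsor) (E : IntermediateField k F) {A : GAlgebra G E}
    (hA : A.IsTorsor) (hAB : EquivHom φ (algebraMap E F) A B) :
    B.essDim k ≤ Cardinal.toENat (Algebra.trdeg k E) := by
  have := hB.nontrivial
  have := hA.finite
  obtain ⟨f, hf, hf'⟩ := hAB
  have hfix : ∀ c : A.fixedSubalgebra φ, ∃ d : F, algebraMap F B.carrier d = f c := fun c =>
    hB.exists_algebraMap_eq fun h => by rw [← hf', c.2 h]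
  choose ψ hψ using hfix
  have hinj := FaithfulSMul.algebraMap_injective F B.carrier
  let ψ' : A.fixedSubalgebra φ →ₐ[E] F :=
    { toFun := ψ
      map_one' := hinj (by simp [hψ])
      map_mul' := fun a b => hinj (by simp [hψ])
      map_zero' := hinj (by simp [hψ])
      map_add' := fun a b => hinj (by simp [hψ])
      commutes' := fun c => hinj (by rw [hψ]; exact hf c) }
  let E' : IntermediateField E F := IntermediateField.adjoin E (Set.range ψ')
  have : Algebra.IsAlgebraic E E' := by
    refine IntermediateField.isAlgebraic_adjoin ?_
    rintro _ ⟨c, rfl⟩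
    exact (Algebra.IsIntegral.isIntegral (R := E) c).map ψ'
  let ψ₀ : A.fixedSubalgebra φ →+* E'.restrictScalars k :=
    RingHom.codRestrict (ψ' : A.fixedSubalgebra φ →+* F) (E'.restrictScalars k) fun c =>
      IntermediateField.subset_adjoin E _ ⟨c, rfl⟩
  let : Algebra (A.fixedSubalgebra φ) (E'.restrictScalars k) := ψ₀.toAlgebra
  rw [← trdeg_restrictScalars_eq E E']
  refine iInf_le_of_le (E'.restrictScalars k) <|
    iInf_le_of_le (A.reduction φ (E'.restrictScalars k)) <|
    iInf_le_of_le (hA.reduction hφ _) <| iInf_le_of_le ?_ le_rfl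
  have h : EquivHom (MonoidHom.id H) (algebraMap (E'.restrictScalars k) F)
      (A.reduction φ (E'.restrictScalars k)) B :=
    EquivHom.of_reduction f (fun c => (hψ c).symm) hf'
  exact h.lift.iso ((hA.reduction hφ _).baseChange F) hB

theorem essDimAt_le_essDimAt_induced [Finite G] [Finite H] (hφ : Function.Injective φ)
    {B : GAlgebra H F} (hB : B.IsTorsor) (l : ℕ) :
    B.essDimAt k l ≤ (induced φ B).essDimAt k l := by
  unfold essDimAt
  refine le_iInf fun L => le_iInf fun _ => le_iInf fun _ => le_iInf fun _ => le_iInf fun _ =>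
    le_iInf fun hfin => le_iInf fun hL => ?_
  refine iInf_le_of_le L <| iInf_le_of_le inferInstance <| iInf_le_of_le inferInstance <|
    iInf_le_of_le inferInstance <| iInf_le_of_le inferInstance <| iInf_le_of_le hfin <|
    iInf_le_of_le hL ?_
  refine le_iInf fun E => le_iInf fun A₀ => le_iInf fun hA₀ => le_iInf fun hiso => ?_
  refine essDim_le_of_equivHom (φ := φ) hφ (hB.baseChange L) E hA₀ ?_
  have h₁ : EquivHom φ (algebraMap F L) (induced φ B) (B.baseChange L) :=
    (equivHom_induced φ B).comp (equivHom_baseChange B L)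
  exact ((equivHom_baseChange A₀ L).comp hiso.equivHom).comp h₁.lift

theorem IsTorsor.exists_residue_reduction [Finite G] [Finite H] (hφ : Function.Injective φ) {l : ℕ}
    (hindex : ¬ l ∣ φ.range.index) {A : GAlgebra G F} (hA : A.IsTorsor) :
    ∃ (F' : Type u) (_ : Field F') (_ : Algebra F F') (B : GAlgebra H F'),
      FiniteDimensional F F' ∧ ¬ l ∣ Module.finrank F F' ∧ B.IsTorsor ∧
        EquivHom φ (algebraMap F F') A B := by
  have := hA.finite
  rw [← finrank_fixedSubalgebra hφ hA] at hindex
  obtain ⟨m, hm, hlm⟩ := exists_isMaximal_not_dvd_finrank hindex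
  let := Ideal.Quotient.field m
  exact ⟨A.fixedSubalgebra φ ⧸ m, inferInstance, inferInstance, A.reduction φ _, inferInstance,
    hlm, hA.reduction hφ _, equivHom_reduction fun c => rfl⟩

end EssentialDimension

end GAlgebra

/-- A subgroup of index prime to `l` has the same essential `l`-dimension. -/
theorem essentialDimensionAt_eq_of_injective {G H : Type} [Group G] [Group H] [Finite G]
    (k : Type u) [Field k] {l : ℕ} (hl : l.Prime) (φ : H →* G) (hφ : Function.Injective φ)
    (hindex : ¬ l ∣ φ.range.index) :
    essentialDimensionAt k H l = essentialDimensionAt k G l := by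
  have := Finite.of_injective φ hφ
  apply le_antisymm
  · refine iSup_le fun F => iSup_le fun _ => iSup_le fun _ => iSup_le fun B => iSup_le fun hB => ?_
    refine (GAlgebra.essDimAt_le_essDimAt_induced hφ hB l).trans ?_
    exact le_iSup_of_le F <| le_iSup_of_le inferInstance <| le_iSup_of_le inferInstance <|
      le_iSup_of_le (GAlgebra.induced φ B) <| le_iSup_of_le (hB.induced hφ) le_rfl
  · refine iSup_le fun F => iSup_le fun _ => iSup_le fun _ => iSup_le fun A => iSup_le fun hA => ?_
    obtain ⟨F', _, _, B, _, hdeg, hB, hAB⟩ := hA.exists_residue_reduction hφ hindex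
    let : Algebra k F' := ((algebraMap F F').comp (algebraMap k F)).toAlgebra
    have : IsScalarTower k F F' := IsScalarTower.of_algebraMap_eq fun _ => rfl
    refine (hAB.essDimAt_le (k := k) hl hdeg hφ hA).trans ?_
    exact le_iSup_of_le F' <| le_iSup_of_le inferInstance <| le_iSup_of_le inferInstance <|
      le_iSup_of_le B <| le_iSup_of_le hB le_rfl

/-! ### Orthonormal bases of Hermitian forms -/

section Hermitian

variable {K : Type*} [Field K] {n : ℕ}

/-- The sesquilinear form with matrix `β`. -/
def sesqForm (σ : K →+* K) (β : Matrix (Fin n) (Fin n) K) (u v : Fin n → K) : K :=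
  u ⬝ᵥ β.mulVec (fun i => σ (v i))

variable {σ : K →+* K} {β : Matrix (Fin n) (Fin n) K}

theorem sesqForm_eq_sum (u v : Fin n → K) :
    sesqForm σ β u v = ∑ i, ∑ j, u i * β i j * σ (v j) := by
  simp only [sesqForm, dotProduct, Matrix.mulVec, Finset.mul_sum, mul_assoc]

theorem sesqForm_add_left (u u' v : Fin n → K) :
    sesqForm σ β (u + u') v = sesqForm σ β u v + sesqForm σ β u' v := by
  simp only [sesqForm_eq_sum, Pi.add_apply, add_mul, Finset.sum_add_distrib]

theorem sesqForm_smul_left (c : K) (u v : Fin n → K) :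
    sesqForm σ β (c • u) v = c * sesqForm σ β u v := by
  simp only [sesqForm_eq_sum, Pi.smul_apply, smul_eq_mul, Finset.mul_sum, mul_assoc]

/-- The form as a linear map in its first argument. -/
def sesqFormLeft (σ : K →+* K) (β : Matrix (Fin n) (Fin n) K) (v : Fin n → K) :
    (Fin n → K) →ₗ[K] K where
  toFun u := sesqForm σ β u v
  map_add' u u' := sesqForm_add_left u u' v
  map_smul' c u := sesqForm_smul_left c u v

theorem map_sesqForm (hσ : ∀ a, σ (σ a) = a) (hβ : β.transpose = β.map σ) (u v : Fin n → K) :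
    σ (sesqForm σ β u v) = sesqForm σ β v u := by
  have h : ∀ i j, σ (β i j) = β j i := fun i j => (congrFun (congrFun hβ i) j).symm
  simp only [sesqForm_eq_sum, map_sum, map_mul, hσ, h]
  rw [Finset.sum_comm]
  exact Finset.sum_congr rfl fun i _ => Finset.sum_congr rfl fun j _ => by ring

theorem sesqForm_add_right (hσ : ∀ a, σ (σ a) = a) (hβ : β.transpose = β.map σ)
    (u v v' : Fin n → K) :
    sesqForm σ β u (v + v') = sesqForm σ β u v + sesqForm σ β u v' := by
  rw [← map_sesqForm hσ hβ, sesqForm_add_left, map_add, map_sesqForm hσ hβ, map_sesqForm hσ hβ]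

theorem sesqForm_smul_right (hσ : ∀ a, σ (σ a) = a) (hβ : β.transpose = β.map σ)
    (c : K) (u v : Fin n → K) :
    sesqForm σ β u (c • v) = σ c * sesqForm σ β u v := by
  rw [← map_sesqForm hσ hβ, sesqForm_smul_left, map_mul, map_sesqForm hσ hβ]

/-- If `u` and `v` are isotropic, the form takes the value `c + σ c` at `(c / ⟨u, v⟩) u + v`. The
trace condition stands in for invertibility of `2`. -/
theorem exists_sesqForm_self_ne_zero (hσ : ∀ a, σ (σ a) = a) (hβ : β.transpose = β.map σ)
    (htr : ∃ c, c + σ c ≠ 0) {u v : Fin n → K}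
    (huv : sesqForm σ β u v ≠ 0) : ∃ a b : K, sesqForm σ β (a • u + b • v) (a • u + b • v) ≠ 0 := by
  by_contra! h
  have hu : sesqForm σ β u u = 0 := by simpa using h 1 0
  have hv : sesqForm σ β v v = 0 := by simpa using h 0 1
  obtain ⟨c, hc⟩ := htr
  apply hc
  have := h (c / sesqForm σ β u v) 1
  rw [one_smul, sesqForm_add_left, sesqForm_add_right hσ hβ, sesqForm_add_right hσ hβ,
    sesqForm_smul_left, sesqForm_smul_left, sesqForm_smul_right hσ hβ,
    sesqForm_smul_right hσ hβ, hu, hv, ← map_sesqForm hσ hβ u v, ← map_mul,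
    div_mul_cancel₀ _ huv] at this
  simpa using this

/-- Take `w ≠ 0` orthogonal to the family and `z` with `⟨w, z⟩ ≠ 0`. Removing from `z` its
projection `s` to the span of the family keeps this pairing, so the orthogonal complement contains
an anisotropic vector, which a norm rescales to length one. -/
theorem exists_orthonormal_extension (hσ : ∀ a, σ (σ a) = a) (hβ : β.transpose = β.map σ)
    (hnorm : ∀ a, σ a = a → a ≠ 0 → ∃ c, c * σ c = a)
    (htr : ∃ c, c + σ c ≠ 0) (hβ' : IsUnit β.det) {m : ℕ} (hm : m < n) (v : Fin m → Fin n → K)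
    (hv : ∀ i j, sesqForm σ β (v i) (v j) = if i = j then 1 else 0) :
    ∃ w, (∀ i, sesqForm σ β w (v i) = 0) ∧ sesqForm σ β w w = 1 := by
  let L : (Fin n → K) →ₗ[K] (Fin m → K) := LinearMap.pi fun i => sesqFormLeft σ β (v i)
  have hL : ∀ w, L w = 0 ↔ ∀ i, sesqForm σ β w (v i) = 0 := fun w => funext_iff
  obtain ⟨w, hw, hw0⟩ := (Submodule.ne_bot_iff _).1
    (LinearMap.ker_ne_bot_of_finrank_lt (f := L) (by simpa using hm))
  obtain ⟨j, hj⟩ : ∃ j, (Matrix.vecMul w β) j ≠ 0 := by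
    by_contra! h
    apply hw0
    have h1 : Matrix.vecMul w β = 0 := funext h
    have := congrArg (fun x => Matrix.vecMul x β⁻¹) h1
    simpa [Matrix.vecMul_vecMul, Matrix.mul_nonsing_inv _ hβ'] using this
  let z : Fin n → K := Pi.single j 1
  have hwz : sesqForm σ β w z ≠ 0 := by
    have : (fun i => σ (z i)) = Pi.single j 1 := by
      funext i
      by_cases hij : i = j
      · subst hij; simp [z]
      · simp [z, hij]
    rw [sesqForm, this, Matrix.dotProduct_mulVec]
    simpa using hj
  let s : Fin n → K := ∑ i, sesqForm σ β z (v i) • v i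
  have hs : ∀ j, sesqForm σ β s (v j) = sesqForm σ β z (v j) := fun j => by
    change sesqFormLeft σ β (v j) s = _
    rw [map_sum]
    change ∑ i, sesqForm σ β (_ • v i) (v j) = _
    simp [sesqForm_smul_left, hv]
  have hws : sesqForm σ β w s = 0 := by
    rw [← map_sesqForm hσ hβ]
    change σ (sesqFormLeft σ β w s) = 0
    rw [map_sum]
    change σ (∑ i, sesqForm σ β (_ • v i) w) = 0
    rw [Finset.sum_eq_zero, map_zero]
    intro i _
    rw [sesqForm_smul_left, ← map_sesqForm hσ hβ w, (hL w).1 hw i, map_zero, mul_zero]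
  have hz' : L (z + (-1 : K) • s) = 0 := (hL _).2 fun i => by
    rw [sesqForm_add_left, sesqForm_smul_left, hs]; ring
  obtain ⟨a, b, hab⟩ := exists_sesqForm_self_ne_zero hσ hβ htr (u := w) (v := z + (-1 : K) • s) (by
    rwa [sesqForm_add_right hσ hβ, sesqForm_smul_right hσ hβ, hws, mul_zero, add_zero])
  set x := a • w + b • (z + (-1 : K) • s) with hx
  have hLx : L x = 0 := by
    rw [hx, map_add, map_smul, map_smul, hz', LinearMap.mem_ker.1 hw]; simp
  obtain ⟨c, hc⟩ := hnorm (sesqForm σ β x x)⁻¹ (by rw [map_inv₀, map_sesqForm hσ hβ])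
    (inv_ne_zero hab)
  refine ⟨c • x, fun i => ?_, ?_⟩
  · rw [sesqForm_smul_left, (hL x).1 hLx i, mul_zero]
  · rw [sesqForm_smul_left, sesqForm_smul_right hσ hβ, ← mul_assoc, hc, inv_mul_cancel₀ hab]

theorem exists_orthonormal_family (hσ : ∀ a, σ (σ a) = a) (hβ : β.transpose = β.map σ)
    (hnorm : ∀ a, σ a = a → a ≠ 0 → ∃ c, c * σ c = a)
    (htr : ∃ c, c + σ c ≠ 0) (hβ' : IsUnit β.det) (m : ℕ) (hm : m ≤ n) :
    ∃ v : Fin m → Fin n → K, ∀ i j, sesqForm σ β (v i) (v j) = if i = j then 1 else 0 := by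
  induction m with
  | zero => exact ⟨Fin.elim0, fun i => i.elim0⟩
  | succ m ih =>
    obtain ⟨v, hv⟩ := ih (by omega)
    obtain ⟨w, hw, hw1⟩ := exists_orthonormal_extension hσ hβ hnorm htr hβ' (by omega) v hv
    refine ⟨Fin.cons w v, fun i j => ?_⟩
    refine Fin.cases ?_ (fun i => ?_) i <;> refine Fin.cases ?_ (fun j => ?_) j
    · simpa using hw1
    · simpa [(Fin.succ_ne_zero j).symm] using hw j
    · have := congrArg σ (hw i)
      rw [map_sesqForm hσ hβ, map_zero] at this
      simpa using this
    · simpa using hv i j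

/-- A nondegenerate Hermitian form with surjective norms has an orthonormal basis. -/
theorem exists_congruent_one (hσ : ∀ a, σ (σ a) = a) (hβ : β.transpose = β.map σ)
    (hnorm : ∀ a, σ a = a → a ≠ 0 → ∃ c, c * σ c = a)
    (htr : ∃ c, c + σ c ≠ 0) (hβ' : IsUnit β.det) :
    ∃ P : GL (Fin n) K, (P : Matrix (Fin n) (Fin n) K).transpose * β *
      (P : Matrix (Fin n) (Fin n) K).map σ = 1 := by
  obtain ⟨v, hv⟩ := exists_orthonormal_family hσ hβ hnorm htr hβ' n le_rfl
  let P : Matrix (Fin n) (Fin n) K := Matrix.of fun i j => v j i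
  have hP : P.transpose * β * P.map σ = 1 := by
    ext i j
    rw [Matrix.one_apply, ← hv i j, sesqForm_eq_sum, Matrix.mul_apply, Finset.sum_comm]
    refine Finset.sum_congr rfl fun a _ => ?_
    rw [Matrix.mul_apply, Finset.sum_mul]
    rfl
  have hdet : P.det ≠ 0 := fun h => by
    have := congrArg Matrix.det hP
    simp [h] at this
  exact ⟨Matrix.GeneralLinearGroup.mkOfDetNeZero P hdet, hP⟩

end Hermitian

/-! ### Congruent forms have conjugate unitary groups -/

section Conjugation

variable {K : Type*} [Field K] {n : ℕ} {σ : K →+* K} {β : Matrix (Fin n) (Fin n) K}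

theorem mem_unitaryGroupOf {M : GL (Fin n) K} :
    M ∈ unitaryGroupOf σ β ↔ (M : Matrix (Fin n) (Fin n) K).transpose * β *
      (M : Matrix (Fin n) (Fin n) K).map σ = β := Iff.rfl

theorem mem_specialUnitaryGroupOf {M : GL (Fin n) K} :
    M ∈ specialUnitaryGroupOf σ β ↔
      M ∈ unitaryGroupOf σ β ∧ Matrix.GeneralLinearGroup.det M = 1 := Iff.rfl

theorem conj_mem_unitaryGroupOf {P : GL (Fin n) K}
    (hP : (P : Matrix (Fin n) (Fin n) K).transpose * β *
      (P : Matrix (Fin n) (Fin n) K).map σ = 1) {M : GL (Fin n) K}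
    (hM : M ∈ unitaryGroupOf σ 1) : P * M * P⁻¹ ∈ unitaryGroupOf σ β := by
  rw [mem_unitaryGroupOf] at hM ⊢
  set p : Matrix (Fin n) (Fin n) K := P.val with hp
  set p' : Matrix (Fin n) (Fin n) K := (P⁻¹).val with hp'
  have h1 : p'.transpose * p.transpose = 1 := by
    rw [← Matrix.transpose_mul, hp, hp', ← Units.val_mul]; simp
  have h2 : p.map σ * p'.map σ = 1 := by
    rw [← Matrix.map_mul, hp, hp', ← Units.val_mul]; simp
  rw [Matrix.mul_one] at hM
  simp only [Units.val_mul, Matrix.transpose_mul, Matrix.map_mul]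
  calc _ = p'.transpose * ((M : Matrix (Fin n) (Fin n) K).transpose *
        (p.transpose * β * p.map σ) * (M : Matrix (Fin n) (Fin n) K).map σ) * p'.map σ := by
        simp only [Matrix.mul_assoc, hp, hp']
    _ = p'.transpose * (p.transpose * β * p.map σ) * p'.map σ := by
      rw [hP, Matrix.mul_one, hM]
    _ = (p'.transpose * p.transpose) * β * (p.map σ * p'.map σ) := by
      simp only [Matrix.mul_assoc]
    _ = β := by rw [h1, h2, Matrix.one_mul, Matrix.mul_one]

theorem conj_mem_specialUnitaryGroupOf {P : GL (Fin n) K}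
    (hP : (P : Matrix (Fin n) (Fin n) K).transpose * β *
      (P : Matrix (Fin n) (Fin n) K).map σ = 1) {M : GL (Fin n) K}
    (hM : M ∈ specialUnitaryGroupOf σ 1) : P * M * P⁻¹ ∈ specialUnitaryGroupOf σ β :=
  ⟨conj_mem_unitaryGroupOf hP hM.1, by
    have : Matrix.GeneralLinearGroup.det M = 1 := hM.2
    change Matrix.GeneralLinearGroup.det (P * M * P⁻¹) = 1
    rw [map_mul, map_mul, this, map_inv, mul_one, mul_inv_cancel]⟩

end Conjugation

/-! ### Norm and trace for the field with `q ^ 2` elements -/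

section FiniteField

variable {K : Type*} [Field K] {q : ℕ} {σ : K →+* K}

theorem card_units_of_card_eq_sq (hK : Nat.card K = q ^ 2) :
    Nat.card Kˣ = (q - 1) * (q + 1) := by
  rw [Nat.card_units, hK, mul_comm, ← Nat.sq_sub_sq, one_pow]

variable [Finite K]

theorem one_lt_of_card_eq_sq (hK : Nat.card K = q ^ 2) : 1 < q := by
  have := Finite.one_lt_card (α := K)
  rw [hK] at this
  by_contra! h
  have : q ^ 2 ≤ 1 ^ 2 := Nat.pow_le_pow_left h 2
  omega

theorem conj_conj_of_card_eq_sq (hK : Nat.card K = q ^ 2) (hσ : ∀ a, σ a = a ^ q) (a : K) :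
    σ (σ a) = a := by
  have := Fintype.ofFinite K
  rw [hσ, hσ, ← pow_mul, ← sq, ← hK, Nat.card_eq_fintype_card, FiniteField.pow_card]

theorem card_ker_pow_sub_one (hK : Nat.card K = q ^ 2) :
    Nat.card (powMonoidHom (q - 1) : Kˣ →* Kˣ).ker = q - 1 := by
  rw [IsCyclic.card_powMonoidHom_ker, card_units_of_card_eq_sq hK, Nat.gcd_eq_right]
  exact Dvd.intro _ rfl

theorem card_ker_pow_add_one (hK : Nat.card K = q ^ 2) :
    Nat.card (powMonoidHom (q + 1) : Kˣ →* Kˣ).ker = q + 1 := by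
  rw [IsCyclic.card_powMonoidHom_ker, card_units_of_card_eq_sq hK, Nat.gcd_eq_right]
  exact Dvd.intro_left _ rfl

/-- In the cyclic group `Kˣ` of order `(q - 1) * (q + 1)`, the `(q + 1)`-th powers and the solutions
of `z ^ (q - 1) = 1` are both the subgroup of order `q - 1`. -/
theorem exists_mul_conj_eq (hK : Nat.card K = q ^ 2) (hσ : ∀ a, σ a = a ^ q) {a : K}
    (ha : σ a = a) (ha0 : a ≠ 0) : ∃ c, c * σ c = a := by
  have hq := one_lt_of_card_eq_sq hK
  have hle : (powMonoidHom (q + 1) : Kˣ →* Kˣ).range ≤ (powMonoidHom (q - 1) : Kˣ →* Kˣ).ker := by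
    rintro _ ⟨c, rfl⟩
    rw [MonoidHom.mem_ker, powMonoidHom_apply, powMonoidHom_apply, ← pow_mul, mul_comm,
      ← card_units_of_card_eq_sq hK, pow_card_eq_one']
  have heq := Subgroup.eq_of_le_of_card_ge hle (by
    rw [card_ker_pow_sub_one hK, IsCyclic.card_powMonoidHom_range, card_units_of_card_eq_sq hK,
      Nat.gcd_eq_right (Dvd.intro_left _ rfl), Nat.mul_div_cancel _ (by omega)])
  have hmem : Units.mk0 a ha0 ∈ (powMonoidHom (q - 1) : Kˣ →* Kˣ).ker := by
    rw [MonoidHom.mem_ker, powMonoidHom_apply]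
    ext
    apply mul_right_cancel₀ ha0
    rw [Units.val_pow_eq_pow_val, Units.val_mk0, ← pow_succ, Nat.sub_add_cancel hq.le, ← hσ, ha]
    simp
  rw [← heq] at hmem
  obtain ⟨c, hc⟩ := hmem
  refine ⟨c, ?_⟩
  rw [hσ, ← pow_succ']
  simpa using congrArg Units.val hc

/-- Otherwise `c = 1` gives `-1 = 1`, so `σ` is the identity and all units satisfy `z ^ (q - 1) =
1`, too many. -/
theorem exists_add_conj_ne_zero (hK : Nat.card K = q ^ 2) (hσ : ∀ a, σ a = a ^ q) :
    ∃ c, c + σ c ≠ 0 := by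
  by_contra! h
  have hq := one_lt_of_card_eq_sq hK
  have h2 : (-1 : K) = 1 := by
    have := h 1
    rw [map_one] at this
    exact neg_eq_of_add_eq_zero_right this
  have hker : (powMonoidHom (q - 1) : Kˣ →* Kˣ).ker = ⊤ := by
    rw [eq_top_iff]
    intro a _
    rw [MonoidHom.mem_ker, powMonoidHom_apply]
    ext
    apply mul_right_cancel₀ a.ne_zero
    have := eq_neg_of_add_eq_zero_right (h a)
    rw [← neg_one_mul, h2, one_mul, hσ] at this
    rw [Units.val_pow_eq_pow_val, ← pow_succ, Nat.sub_add_cancel hq.le, this]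
    simp
  have hc := card_ker_pow_sub_one hK
  rw [hker, Subgroup.card_top, card_units_of_card_eq_sq hK] at hc
  have := Nat.eq_of_mul_eq_mul_left (by omega) (hc.trans (mul_one _).symm)
  omega

theorem exists_pow_eq_one_sq_ne_one (hK : Nat.card K = q ^ 2) :
    ∃ ζ : Kˣ, ζ ^ (q + 1) = 1 ∧ ζ ≠ ζ⁻¹ := by
  by_contra! h
  have hq := one_lt_of_card_eq_sq hK
  have hle : (powMonoidHom (q + 1) : Kˣ →* Kˣ).ker ≤ (powMonoidHom 2 : Kˣ →* Kˣ).ker := by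
    intro a ha
    rw [MonoidHom.mem_ker, powMonoidHom_apply] at *
    rw [sq]
    exact mul_eq_one_iff_eq_inv.2 (h a ha)
  have := Nat.card_le_card_of_injective _ (Subgroup.inclusion_injective hle)
  rw [card_ker_pow_add_one hK, IsCyclic.card_powMonoidHom_ker] at this
  have h2 : (Nat.card Kˣ).gcd 2 ≤ 2 := Nat.gcd_le_right _ (by norm_num)
  omega

theorem exists_congruent_one_of_card_eq_sq {n : ℕ} {β : Matrix (Fin n) (Fin n) K}
    (hK : Nat.card K = q ^ 2) (hσ : ∀ a, σ a = a ^ q) (hβ : β.transpose = β.map σ)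
    (hβ' : IsUnit β.det) :
    ∃ P : GL (Fin n) K, (P : Matrix (Fin n) (Fin n) K).transpose * β *
      (P : Matrix (Fin n) (Fin n) K).map σ = 1 :=
  exists_congruent_one (conj_conj_of_card_eq_sq hK hσ) hβ
    (fun _ ha ha0 => exists_mul_conj_eq hK hσ ha ha0) (exists_add_conj_ne_zero hK hσ) hβ'

end FiniteField

/-! ### Matrices commuting with the special unitary group -/

section Monomial

variable {K : Type*} [Field K] {n : ℕ} {σ : K →+* K}

/-- Invertible diagonal matrices. -/
def glDiagonal (K : Type*) [Field K] (n : ℕ) : (Fin n → Kˣ) →* GL (Fin n) K :=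
  MonoidHom.toHomUnits
    { toFun := fun d => Matrix.diagonal fun i => (d i : K)
      map_one' := by simp
      map_mul' := fun d e => by simp [Matrix.diagonal_mul_diagonal] }

/-- Permutation matrices. -/
def glPerm (K : Type*) [Field K] (n : ℕ) : Equiv.Perm (Fin n) →* GL (Fin n) K :=
  MonoidHom.toHomUnits (Matrix.permMatrixHom (R := K))

theorem coe_glDiagonal (d : Fin n → Kˣ) :
    (glDiagonal K n d : Matrix (Fin n) (Fin n) K) = Matrix.diagonal fun i => (d i : K) := rfl

theorem coe_glPerm (s : Equiv.Perm (Fin n)) :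
    (glPerm K n s : Matrix (Fin n) (Fin n) K) = (s⁻¹).permMatrix K := rfl

theorem glPerm_apply (s : Equiv.Perm (Fin n)) (i j : Fin n) :
    (glPerm K n s : Matrix (Fin n) (Fin n) K) i j = if i = s j then 1 else 0 := by
  rw [coe_glPerm, Equiv.Perm.permMatrix, PEquiv.toMatrix_apply]
  simp [Equiv.symm_apply_eq, Equiv.Perm.inv_def]

theorem glDiagonal_mul_glPerm_apply (d : Fin n → Kˣ) (s : Equiv.Perm (Fin n)) (i j : Fin n) :
    ((glDiagonal K n d * glPerm K n s : GL (Fin n) K) : Matrix (Fin n) (Fin n) K) i j =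
      if i = s j then (d i : K) else 0 := by
  rw [Units.val_mul, coe_glDiagonal, Matrix.diagonal_mul, glPerm_apply]
  simp

theorem glDiagonal_mem_unitaryGroupOf {d : Fin n → Kˣ} (hd : ∀ i, (d i : K) * σ (d i) = 1) :
    glDiagonal K n d ∈ unitaryGroupOf σ 1 := by
  rw [mem_unitaryGroupOf, coe_glDiagonal, Matrix.diagonal_transpose, Matrix.mul_one,
    Matrix.diagonal_map (map_zero σ), Matrix.diagonal_mul_diagonal, ← Matrix.diagonal_one]
  congr 1
  funext i
  exact hd i

theorem glPerm_mem_unitaryGroupOf (s : Equiv.Perm (Fin n)) :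
    glPerm K n s ∈ unitaryGroupOf σ 1 := by
  have h : (glPerm K n s : Matrix (Fin n) (Fin n) K).map σ = glPerm K n s := by
    ext i j
    rw [Matrix.map_apply, glPerm_apply]
    split_ifs <;> simp
  rw [mem_unitaryGroupOf, h, Matrix.mul_one, coe_glPerm, Matrix.transpose_permMatrix, inv_inv,
    ← Matrix.permMatrix_mul]
  simp

theorem det_glDiagonal (d : Fin n → Kˣ) :
    Matrix.GeneralLinearGroup.det (glDiagonal K n d) = ∏ i, d i := by
  ext
  rw [Matrix.GeneralLinearGroup.val_det_apply, coe_glDiagonal, Matrix.det_diagonal]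
  simp

theorem val_det_glPerm (s : Equiv.Perm (Fin n)) :
    ((Matrix.GeneralLinearGroup.det (glPerm K n s) : Kˣ) : K) = (Equiv.Perm.sign s : ℤ) := by
  rw [Matrix.GeneralLinearGroup.val_det_apply, coe_glPerm, Matrix.det_permutation]
  simp

/-- A matrix that commutes with the special unitary group of the standard form is scalar. -/
theorem eq_scalar_of_commute_one {q : ℕ} [Finite K] (hK : Nat.card K = q ^ 2)
    (hσ : ∀ a, σ a = a ^ q) {M : Matrix (Fin n) (Fin n) K}
    (hM : ∀ N ∈ specialUnitaryGroupOf σ (1 : Matrix (Fin n) (Fin n) K),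
      M * (N : Matrix (Fin n) (Fin n) K) = (N : Matrix (Fin n) (Fin n) K) * M) :
    ∃ c, M = Matrix.scalar (Fin n) c := by
  have hoff : ∀ i j, i ≠ j → M i j = 0 := by
    intro i j hij
    obtain ⟨ζ, hζ, hζ'⟩ := exists_pow_eq_one_sq_ne_one hK
    have hζσ : ∀ z : Kˣ, z ^ (q + 1) = 1 → (z : K) * σ z = 1 := fun z hz => by
      rw [hσ, ← pow_succ', ← Units.val_pow_eq_pow_val, hz, Units.val_one]
    -- A diagonal element of determinant one with distinct entries `ζ`, `ζ⁻¹` at `i`, `j` forces `M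
    -- i j = 0`.
    let d : Fin n → Kˣ := Pi.mulSingle i ζ * Pi.mulSingle j ζ⁻¹
    have hdi : d i = ζ := by simp [d, hij]
    have hdj : d j = ζ⁻¹ := by simp [d, Ne.symm hij]
    have hd : glDiagonal K n d ∈ specialUnitaryGroupOf σ (1 : Matrix (Fin n) (Fin n) K) := by
      refine mem_specialUnitaryGroupOf.2 ⟨glDiagonal_mem_unitaryGroupOf fun a => ?_, ?_⟩
      · apply hζσ
        by_cases hai : a = i
        · rw [hai, hdi, hζ]
        by_cases haj : a = j
        · rw [haj, hdj, inv_pow, hζ, inv_one]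
        · simp [d, hai, haj]
      · rw [det_glDiagonal]
        simp [d, Finset.prod_mul_distrib]
    have h := congrFun (congrFun (hM _ hd) i) j
    rw [coe_glDiagonal, Matrix.mul_diagonal, Matrix.diagonal_mul, hdi, hdj] at h
    by_contra hne
    rw [mul_comm] at h
    exact hζ' (Units.ext (mul_right_cancel₀ hne h.symm))
  have hdiag : ∀ i j, M i i = M j j := by
    intro i j
    by_cases hij : i = j
    · rw [hij]
    -- The sign at `i` corrects the determinant of the transposition.
    let N := glDiagonal K n (Pi.mulSingle i (-1)) * glPerm K n (Equiv.swap i j)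
    have hN : N ∈ specialUnitaryGroupOf σ (1 : Matrix (Fin n) (Fin n) K) := by
      refine mem_specialUnitaryGroupOf.2 ⟨mul_mem (glDiagonal_mem_unitaryGroupOf fun a => ?_)
        (glPerm_mem_unitaryGroupOf _), ?_⟩
      · by_cases hai : a = i
        · subst hai; simp
        · simp [hai]
      · ext
        rw [map_mul, Units.val_mul, val_det_glPerm, det_glDiagonal, Equiv.Perm.sign_swap hij]
        simp
    have hNij : ∀ a b, (N : Matrix (Fin n) (Fin n) K) a b =
      if a = Equiv.swap i j b then ((Pi.mulSingle i (-1) : Fin n → Kˣ) a : K) else 0 :=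
      glDiagonal_mul_glPerm_apply _ _
    have h := congrFun (congrFun (hM N hN) i) j
    rw [Matrix.mul_apply, Matrix.mul_apply,
      Finset.sum_eq_single i (fun b _ hb => by rw [hoff i b (Ne.symm hb), zero_mul]) (by simp),
      Finset.sum_eq_single j (fun b _ hb => by rw [hoff b j hb, mul_zero]) (by simp), hNij] at h
    simp at h
    exact h
  rcases isEmpty_or_nonempty (Fin n) with _ | ⟨⟨i⟩⟩
  · exact ⟨0, Subsingleton.elim _ _⟩
  · refine ⟨M i i, ?_⟩
    ext a b
    by_cases hab : a = b
    · subst hab; simp [hdiag a i]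
    · simp [hoff a b hab, hab]

theorem eq_scalar_of_commute {q : ℕ} [Finite K] (hK : Nat.card K = q ^ 2)
    (hσ : ∀ a, σ a = a ^ q) {β : Matrix (Fin n) (Fin n) K} (hβ : β.transpose = β.map σ)
    (hβ' : IsUnit β.det) {M : GL (Fin n) K} (hM : ∀ N ∈ specialUnitaryGroupOf σ β, M * N = N * M) :
    ∃ c, (M : Matrix (Fin n) (Fin n) K) = Matrix.scalar (Fin n) c := by
  obtain ⟨P, hP⟩ := exists_congruent_one_of_card_eq_sq hK hσ hβ hβ'
  obtain ⟨c, hc⟩ := eq_scalar_of_commute_one hK hσ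
    (M := ((P⁻¹ * M * P : GL (Fin n) K) : Matrix (Fin n) (Fin n) K)) fun N hN => by
      have h := hM _ (conj_mem_specialUnitaryGroupOf hP hN)
      rw [← Units.val_mul, ← Units.val_mul]
      congr 1
      calc P⁻¹ * M * P * N = P⁻¹ * (M * (P * N * P⁻¹)) * P := by group
        _ = P⁻¹ * ((P * N * P⁻¹) * M) * P := by rw [h]
        _ = N * (P⁻¹ * M * P) := by group
  refine ⟨c, ?_⟩
  have h1 : M = P * (P⁻¹ * M * P) * P⁻¹ := by group
  rw [h1, Units.val_mul, Units.val_mul, hc,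
    ← (Matrix.scalar_commute c (fun r => Commute.all c r) _).eq, mul_assoc, ← Units.val_mul]
  simp

end Monomial

/-! ### The `l`-parts of the orders of the unitary and linear groups -/

theorem padicValNat_le_of_dvd {l a b : ℕ} [Fact l.Prime] (hab : a ∣ b) (hb : b ≠ 0) :
    padicValNat l a ≤ padicValNat l b := by
  obtain ⟨c, rfl⟩ := hab
  rw [mul_ne_zero_iff] at hb
  rw [padicValNat.mul hb.1 hb.2]
  exact Nat.le_add_right _ _

theorem not_dvd_of_padicValNat_eq_zero {l a : ℕ} [Fact l.Prime] (ha : a ≠ 0)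
    (h : padicValNat l a = 0) : ¬ l ∣ a := fun hd => by
  have := one_le_padicValNat_of_dvd ha hd
  omega

section UnitaryOrder

variable {K : Type*} [Field K] {n q : ℕ} {σ : K →+* K}

theorem glPerm_mul_glDiagonal (s : Equiv.Perm (Fin n)) (d : Fin n → Kˣ) :
    glPerm K n s * glDiagonal K n d = glDiagonal K n (fun i => d (s⁻¹ i)) * glPerm K n s := by
  ext i j
  rw [glDiagonal_mul_glPerm_apply, Units.val_mul, coe_glDiagonal, Matrix.mul_diagonal,
    glPerm_apply]
  by_cases h : i = s j
  · subst h; simp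
  · simp [h]

/-- The monomial matrices with coefficients in a subgroup of the units. -/
def glMonomial (K : Type*) [Field K] (n : ℕ) (U : Subgroup Kˣ) :
    (Fin n → U) ⋊[mulAutArrow] Equiv.Perm (Fin n) →* GL (Fin n) K :=
  SemidirectProduct.lift ((glDiagonal K n).comp (MonoidHom.pi fun i =>
    U.subtype.comp (Pi.evalMonoidHom _ i))) (glPerm K n) fun s => by
      refine MonoidHom.ext fun d => ?_
      change glDiagonal K n (fun i => (d (s⁻¹ i) : Kˣ)) =
        glPerm K n s * glDiagonal K n (fun i => (d i : Kˣ)) * (glPerm K n s)⁻¹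
      rw [glPerm_mul_glDiagonal, mul_inv_cancel_right]

theorem glMonomial_apply (U : Subgroup Kˣ) (x : (Fin n → U) ⋊[mulAutArrow] Equiv.Perm (Fin n)) :
    glMonomial K n U x = glDiagonal K n (fun i => (x.left i : Kˣ)) * glPerm K n x.right := rfl

theorem glMonomial_injective (U : Subgroup Kˣ) : Function.Injective (glMonomial K n U) := by
  rw [injective_iff_map_eq_one]
  rintro ⟨d, s⟩ h
  rw [glMonomial_apply] at h
  have key : ∀ i j, (if i = s j then ((d i : Kˣ) : K) else 0) = if i = j then 1 else 0 :=
    fun i j => by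
      rw [← glDiagonal_mul_glPerm_apply (fun i => (d i : Kˣ)) s i j, h, Units.val_one,
        Matrix.one_apply]
  have hs : s = 1 := by
    ext j
    by_contra hne
    have hne' : s j ≠ j := fun h => hne (by rw [h]; rfl)
    have := key (s j) j
    rw [if_pos rfl, if_neg hne'] at this
    exact Units.ne_zero _ this
  subst hs
  have hd : d = 1 := by
    funext i
    have := key i i
    simp at this
    exact this
  subst hd
  rfl

/-- Monomial matrices with entries of norm one preserve the standard form. This lower bound replaces
the exact order of the unitary group. -/
theorem pow_mul_factorial_dvd_card_unitaryGroupOf [Finite K] (hK : Nat.card K = q ^ 2)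
    (hσ : ∀ a, σ a = a ^ q) :
    (q + 1) ^ n * n.factorial ∣ Nat.card (unitaryGroupOf σ (1 : Matrix (Fin n) (Fin n) K)) := by
  let U := (powMonoidHom (q + 1) : Kˣ →* Kˣ).ker
  have hmem : ∀ x, glMonomial K n U x ∈ unitaryGroupOf σ (1 : Matrix (Fin n) (Fin n) K) := fun x => by
    rw [glMonomial_apply]
    refine mul_mem (glDiagonal_mem_unitaryGroupOf fun i => ?_) (glPerm_mem_unitaryGroupOf _)
    have : ((x.left i : Kˣ)) ^ (q + 1) = 1 := (x.left i).2
    rw [hσ, ← pow_succ', ← Units.val_pow_eq_pow_val, this, Units.val_one]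
  have := Subgroup.card_dvd_of_injective ((glMonomial K n U).codRestrict _ hmem) fun x y hxy =>
    glMonomial_injective U (congrArg Subtype.val hxy)
  rwa [SemidirectProduct.card, Nat.card_fun, card_ker_pow_add_one hK, Nat.card_fin, Nat.card_perm,
    Nat.card_fin] at this

theorem card_unitaryGroupOf_one_dvd {β : Matrix (Fin n) (Fin n) K} {P : GL (Fin n) K}
    (hP : (P : Matrix (Fin n) (Fin n) K).transpose * β *
      (P : Matrix (Fin n) (Fin n) K).map σ = 1) :
    Nat.card (unitaryGroupOf σ (1 : Matrix (Fin n) (Fin n) K)) ∣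
      Nat.card (unitaryGroupOf σ β) :=
  Subgroup.card_dvd_of_injective
    (((MulAut.conj P).toMonoidHom.comp (unitaryGroupOf σ 1).subtype).codRestrict
      (unitaryGroupOf σ β) fun M => conj_mem_unitaryGroupOf hP M.2) fun _ _ hxy =>
        Subtype.ext ((MulAut.conj P).injective (congrArg Subtype.val hxy))

theorem det_pow_eq_one_of_mem_unitaryGroupOf {β : Matrix (Fin n) (Fin n) K}
    (hσ : ∀ a, σ a = a ^ q) (hβ' : IsUnit β.det) {M : GL (Fin n) K}
    (hM : M ∈ unitaryGroupOf σ β) : Matrix.GeneralLinearGroup.det M ^ (q + 1) = 1 := by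
  have h := congrArg Matrix.det (mem_unitaryGroupOf.1 hM)
  have hmap : ((M : Matrix (Fin n) (Fin n) K).map σ).det = σ (M : Matrix (Fin n) (Fin n) K).det :=
    (σ.map_det _).symm
  rw [Matrix.det_mul, Matrix.det_mul, Matrix.det_transpose, hmap, hσ] at h
  ext
  rw [Units.val_pow_eq_pow_val, Matrix.GeneralLinearGroup.val_det_apply, Units.val_one]
  apply mul_right_cancel₀ hβ'.ne_zero
  rw [one_mul, pow_succ]
  linear_combination h

theorem card_unitaryGroupOf_dvd [Finite K] (hK : Nat.card K = q ^ 2)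
    {β : Matrix (Fin n) (Fin n) K} (hσ : ∀ a, σ a = a ^ q) (hβ' : IsUnit β.det) :
    Nat.card (unitaryGroupOf σ β) ∣ Nat.card (specialUnitaryGroupOf σ β) * (q + 1) := by
  let δ : unitaryGroupOf σ β →* Kˣ :=
    Matrix.GeneralLinearGroup.det.comp (unitaryGroupOf σ β).subtype
  rw [← Subgroup.card_mul_index δ.ker, Subgroup.index_ker]
  apply mul_dvd_mul
  · exact Subgroup.card_dvd_of_injective
      (((unitaryGroupOf σ β).subtype.comp δ.ker.subtype).codRestrict (specialUnitaryGroupOf σ β)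
        fun M => ⟨M.1.2, M.2⟩) fun _ _ hxy =>
          Subtype.ext (Subtype.ext (congrArg (fun z : specialUnitaryGroupOf σ β => z.1) hxy))
  · rw [← card_ker_pow_add_one hK]
    apply Subgroup.card_dvd_of_le
    rintro _ ⟨M, rfl⟩
    exact det_pow_eq_one_of_mem_unitaryGroupOf hσ hβ' M.2

theorem card_specialLinearGroup_mul_dvd (hn : n ≠ 0) :
    Nat.card (Matrix.SpecialLinearGroup (Fin n) K) * Nat.card Kˣ ∣ Nat.card (GL (Fin n) K) := by
  let δ : GL (Fin n) K →* Kˣ := Matrix.GeneralLinearGroup.det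
  have hδ : Function.Surjective δ := fun c =>
    ⟨glDiagonal K n (Pi.mulSingle ⟨0, Nat.pos_of_ne_zero hn⟩ c), by
      change Matrix.GeneralLinearGroup.det _ = c
      rw [det_glDiagonal]; simp⟩
  rw [← Subgroup.card_mul_index δ.ker, Subgroup.index_ker, MonoidHom.range_eq_top.2 hδ,
    Subgroup.card_top]
  refine mul_dvd_mul_right (Subgroup.card_dvd_of_injective
    (Matrix.SpecialLinearGroup.toGL.codRestrict δ.ker fun M => ?_) fun x y hxy => ?_) _
  · change Matrix.GeneralLinearGroup.det _ = 1
    ext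
    simp
  · have := congrArg Subtype.val hxy
    exact Subtype.ext (congrArg Units.val this)

theorem not_dvd_of_dvd_add_one {l : ℕ} (hl : l.Prime) (hlq : l ∣ q + 1) : ¬ l ∣ q := fun h =>
  hl.one_lt.ne' (Nat.dvd_one.1 ((Nat.dvd_add_right h).1 hlq))

theorem padicValNat_sq_sub_one {l : ℕ} [hl : Fact l.Prime] (hl2 : l ≠ 2) (hq : 1 < q)
    (hlq : l ∣ q + 1) : padicValNat l (q ^ 2 - 1) = padicValNat l (q + 1) := by
  have h : q ^ 2 - 1 = (q + 1) * (q - 1) := by rw [← Nat.sq_sub_sq, one_pow]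
  rw [h, padicValNat.mul (by omega) (by omega), padicValNat.eq_zero_of_not_dvd (n := q - 1),
    add_zero]
  intro h'
  have h2 : l ∣ 2 := by
    have := Nat.dvd_sub hlq h'
    rwa [show q + 1 - (q - 1) = 2 by omega] at this
  exact hl2 ((Nat.prime_dvd_prime_iff_eq hl.out Nat.prime_two).1 h2)

/-- The product is the order of `GL_n`. Passing from `n` to `n + 1` multiplies it by a power of `Q =
q ^ 2`, prime to `l`, and by `Q ^ (n + 1) - 1`, whose valuation is that of `Q - 1` plus that of `n +
1`. -/
theorem padicValNat_prod_pow_sub_pow {l : ℕ} [hl : Fact l.Prime] (hl2 : l ≠ 2) (hq : 1 < q)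
    (hlq : l ∣ q + 1) (n : ℕ) :
    ∏ i ∈ Finset.range n, ((q ^ 2) ^ n - (q ^ 2) ^ i) ≠ 0 ∧
      padicValNat l (∏ i ∈ Finset.range n, ((q ^ 2) ^ n - (q ^ 2) ^ i)) =
        n * padicValNat l (q + 1) + padicValNat l n.factorial := by
  have hQ : 1 < q ^ 2 := Nat.one_lt_pow two_ne_zero hq
  have hlQ : ¬ l ∣ q ^ 2 := fun h => not_dvd_of_dvd_add_one hl.out hlq (hl.out.dvd_of_dvd_pow h)
  have hlQ1 : l ∣ q ^ 2 - 1 :=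
    hlq.trans ⟨q - 1, by rw [← Nat.sq_sub_sq, one_pow]⟩
  have hQv := padicValNat_sq_sub_one hl2 hq hlq
  generalize q ^ 2 = Q at *
  induction n with
  | zero => simp
  | succ n ih =>
    obtain ⟨ih0, ih⟩ := ih
    have hprod : ∏ i ∈ Finset.range (n + 1), (Q ^ (n + 1) - Q ^ i) =
        (Q ^ n * ∏ i ∈ Finset.range n, (Q ^ n - Q ^ i)) * (Q ^ (n + 1) - 1 ^ (n + 1)) := by
      rw [Finset.prod_range_succ', pow_zero, one_pow]
      congr 1
      rw [Finset.prod_congr rfl fun i _ => show Q ^ (n + 1) - Q ^ (i + 1) = Q * (Q ^ n - Q ^ i) by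
        rw [Nat.mul_sub, ← pow_succ', ← pow_succ'], Finset.prod_mul_distrib]
      simp
    have h1 : Q ^ (n + 1) - 1 ^ (n + 1) ≠ 0 := by
      have := Nat.one_lt_pow (Nat.succ_ne_zero n) hQ
      simp only [Nat.succ_eq_add_one] at this
      rw [one_pow]; omega
    have hQn : Q ^ n ≠ 0 := pow_ne_zero _ (by omega)
    rw [hprod]
    refine ⟨mul_ne_zero (mul_ne_zero hQn ih0) h1, ?_⟩
    rw [padicValNat.mul (mul_ne_zero hQn ih0) h1, padicValNat.mul hQn ih0, ih,
      padicValNat.pow_sub_pow (hl.out.odd_of_ne_two hl2) hQ hlQ1 hlQ (Nat.succ_ne_zero n), hQv,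
      padicValNat.eq_zero_of_not_dvd (fun h => hlQ (hl.out.dvd_of_dvd_pow h)),
      Nat.factorial_succ, padicValNat.mul (Nat.succ_ne_zero n) (Nat.factorial_ne_zero n)]
    ring

/-- For `l ∣ q + 1` odd, the special unitary group has index prime to `l` in `SL_n`. -/
theorem padicValNat_card_specialLinearGroup_le [Finite K] (hK : Nat.card K = q ^ 2)
    {β : Matrix (Fin n) (Fin n) K} (hσ : ∀ a, σ a = a ^ q) (hβ : β.transpose = β.map σ)
    (hβ' : IsUnit β.det) {l : ℕ} [hl : Fact l.Prime] (hl2 : l ≠ 2) (hlq : l ∣ q + 1) :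
    padicValNat l (Nat.card (Matrix.SpecialLinearGroup (Fin n) K)) ≤
      padicValNat l (Nat.card (specialUnitaryGroupOf σ β)) := by
  -- For `n = 0` the determinant is not onto `Kˣ`, so the count below does not apply.
  rcases eq_or_ne n 0 with rfl | hn
  · simp
  have hq := one_lt_of_card_eq_sq hK
  have := Fintype.ofFinite K
  obtain ⟨P, hP⟩ := exists_congruent_one_of_card_eq_sq hK hσ hβ hβ'
  obtain ⟨h0, hGL⟩ := padicValNat_prod_pow_sub_pow hl2 hq hlq n
  have hcard : Nat.card (GL (Fin n) K) = ∏ i ∈ Finset.range n, ((q ^ 2) ^ n - (q ^ 2) ^ i) := by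
    rw [Matrix.card_GL_field, ← Nat.card_eq_fintype_card, hK,
      Fin.prod_univ_eq_prod_range (fun i => (q ^ 2) ^ n - (q ^ 2) ^ i)]
  rw [← hcard] at h0 hGL
  have h1 := padicValNat_le_of_dvd (l := l) (card_specialLinearGroup_mul_dvd (K := K) hn) h0
  rw [padicValNat.mul Nat.card_pos.ne' Nat.card_pos.ne', hGL, Nat.card_units, hK,
    padicValNat_sq_sub_one hl2 hq hlq] at h1
  -- With `v` the `l`-adic valuation, `n * v (q + 1) + v (n!)` is at least `v |SL| + v (q + 1)` by
  -- `h1` and at most `v |SU| + v (q + 1)` by `h2`.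
  have h2 := padicValNat_le_of_dvd (l := l)
    ((pow_mul_factorial_dvd_card_unitaryGroupOf (n := n) hK hσ).trans
      ((card_unitaryGroupOf_one_dvd hP).trans (card_unitaryGroupOf_dvd hK hσ hβ')))
    (mul_ne_zero Nat.card_pos.ne' (by omega))
  rw [padicValNat.mul (by positivity) (Nat.factorial_ne_zero n), padicValNat.pow,
    padicValNat.mul Nat.card_pos.ne' (by omega)] at h2
  omega

end UnitaryOrder

/-! ### Central quotients and Sylow subgroups -/

section GroupTheory

variable {S T : Type*} [Group S] [Group T]

/-- The map of central quotients induced by a homomorphism under which the centers correspond. -/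
def centerQuotientMap (f : S →* T) (hf : (Subgroup.center T).comap f = Subgroup.center S) :
    S ⧸ Subgroup.center S →* T ⧸ Subgroup.center T :=
  QuotientGroup.map _ _ f hf.ge

theorem centerQuotientMap_injective (f : S →* T)
    (hf : (Subgroup.center T).comap f = Subgroup.center S) :
    Function.Injective (centerQuotientMap f hf) := by
  rw [injective_iff_map_eq_one]
  intro x hx
  induction x using QuotientGroup.induction_on with
  | H z =>
    rw [QuotientGroup.eq_one_iff, ← hf, Subgroup.mem_comap, ← QuotientGroup.eq_one_iff]
    exact hx

/-- The center of `S` embeds in that of `T`, so passing to the quotients removes at least as large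
an `l`-part from `T` as from `S`. -/
theorem not_dvd_index_range_centerQuotientMap [Finite T] {l : ℕ} [Fact l.Prime] (f : S →* T)
    (hinj : Function.Injective f) (hf : (Subgroup.center T).comap f = Subgroup.center S)
    (hle : padicValNat l (Nat.card T) ≤ padicValNat l (Nat.card S)) :
    ¬ l ∣ (centerQuotientMap f hf).range.index := by
  have := Finite.of_injective f hinj
  have hZ : Nat.card (Subgroup.center S) ∣ Nat.card (Subgroup.center T) :=
    Subgroup.card_dvd_of_injective ((f.comp (Subgroup.center S).subtype).codRestrict
      (Subgroup.center T) fun z => hf.ge z.2) fun x y hxy =>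
        Subtype.ext (hinj (congrArg Subtype.val hxy))
  have h1 := padicValNat_le_of_dvd (l := l) hZ Nat.card_pos.ne'
  have h2 : Nat.card (T ⧸ Subgroup.center T) =
      Nat.card (S ⧸ Subgroup.center S) * (centerQuotientMap f hf).range.index := by
    rw [← Subgroup.card_mul_index (centerQuotientMap f hf).range,
      Nat.card_congr (MonoidHom.ofInjective (centerQuotientMap_injective f hf)).toEquiv]
  rw [Subgroup.card_eq_card_quotient_mul_card_subgroup (Subgroup.center T),
    Subgroup.card_eq_card_quotient_mul_card_subgroup (Subgroup.center S),
    padicValNat.mul Nat.card_pos.ne' Nat.card_pos.ne',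
    padicValNat.mul Nat.card_pos.ne' Nat.card_pos.ne', h2,
    padicValNat.mul Nat.card_pos.ne' Subgroup.index_ne_zero_of_finite] at hle
  exact not_dvd_of_padicValNat_eq_zero Subgroup.index_ne_zero_of_finite (by omega)

theorem nonempty_sylow_mulEquiv_of_injective [Finite T] {l : ℕ} [Fact l.Prime] (f : S →* T)
    (hinj : Function.Injective f) (hindex : ¬ l ∣ f.range.index) (P : Sylow l S) (Q : Sylow l T) :
    Nonempty (P ≃* Q) := by
  have := Finite.of_injective f hinj
  have hP : IsPGroup l ((P : Subgroup S).map f) := P.isPGroup'.map f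
  have hi : ¬ l ∣ ((P : Subgroup S).map f).index := by
    rw [Subgroup.index_map, (MonoidHom.ker_eq_bot_iff f).2 hinj, sup_bot_eq,
      (Fact.out : l.Prime).dvd_mul, not_or]
    exact ⟨P.not_dvd_index, hindex⟩
  exact ⟨((P : Subgroup S).equivMapOfInjective f hinj).trans ((hP.toSylow hi).equiv Q)⟩

/-- Dividing by a normal subgroup of order prime to `l` does not change the essential
`l`-dimension. -/
theorem essentialDimensionAt_quotient_eq {S : Type} [Group S] [Finite S] (k : Type u) [Field k]
    {l : ℕ} (hl : l.Prime) (N : Subgroup S) [N.Normal] (hN : ¬ l ∣ Nat.card N) :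
    essentialDimensionAt k (S ⧸ N) l = essentialDimensionAt k S l := by
  have := Fact.mk hl
  let P : Sylow l S := default
  have hP : ¬ l ∣ (P : Subgroup S).index := P.not_dvd_index
  -- A Sylow `l`-subgroup meets `N` trivially, so it has index prime to `l` both in `S` and, through
  -- `f`, in `S ⧸ N`.
  let f : (P : Subgroup S) →* S ⧸ N := (QuotientGroup.mk' N).comp (P : Subgroup S).subtype
  have hf : Function.Injective f := by
    rw [injective_iff_map_eq_one]
    intro x hx
    have hxN : (x : S) ∈ N := (QuotientGroup.eq_one_iff _).1 hx
    obtain ⟨m, hm⟩ := P.isPGroup' x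
    have h1 : orderOf (x : S) ∣ Nat.card N := Subgroup.orderOf_dvd_natCard N hxN
    have h2 : orderOf (x : S) ∣ l ^ m :=
      orderOf_dvd_of_pow_eq_one (by simpa using congrArg Subtype.val hm)
    have h3 : Nat.Coprime (l ^ m) (Nat.card N) :=
      Nat.Coprime.pow_left m ((Nat.Prime.coprime_iff_not_dvd hl).2 hN)
    have := Nat.eq_one_of_dvd_coprimes h3 h2 h1
    exact Subtype.ext (orderOf_eq_one_iff.1 this)
  rw [← essentialDimensionAt_eq_of_injective k hl f hf,
    ← essentialDimensionAt_eq_of_injective k hl (P : Subgroup S).subtype Subtype.val_injective]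
  · rwa [Subgroup.range_subtype]
  · rw [MonoidHom.range_comp, Subgroup.range_subtype, Subgroup.index_map,
      MonoidHom.range_eq_top.2 (QuotientGroup.mk'_surjective N), Subgroup.index_top, mul_one]
    exact fun h => hP (h.trans (Subgroup.index_dvd_of_le le_sup_left))

end GroupTheory

/-! ### The center of the special unitary group -/

section Center

variable {K : Type*} [Field K] {n q : ℕ} {σ : K →+* K} {β : Matrix (Fin n) (Fin n) K}

theorem exists_scalar_of_mem_center [Finite K] (hK : Nat.card K = q ^ 2) (hσ : ∀ a, σ a = a ^ q)
    (hβ : β.transpose = β.map σ) (hβ' : IsUnit β.det) {z : specialUnitaryGroupOf σ β}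
    (hz : z ∈ Subgroup.center (specialUnitaryGroupOf σ β)) :
    ∃ c, (z.1 : Matrix (Fin n) (Fin n) K) = Matrix.scalar (Fin n) c :=
  eq_scalar_of_commute hK hσ hβ hβ' fun N hN =>
    (congrArg Subtype.val (Subgroup.mem_center_iff.1 hz ⟨N, hN⟩)).symm

theorem val_det_of_mem_specialUnitaryGroupOf (z : specialUnitaryGroupOf σ β) :
    (z.1 : Matrix (Fin n) (Fin n) K).det = 1 := by
  rw [← Matrix.GeneralLinearGroup.val_det_apply, (mem_specialUnitaryGroupOf.1 z.2).2, Units.val_one]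

/-- The inclusion of the special unitary group in the special linear group. -/
def specialUnitaryToSL (σ : K →+* K) (β : Matrix (Fin n) (Fin n) K) :
    specialUnitaryGroupOf σ β →* Matrix.SpecialLinearGroup (Fin n) K where
  toFun z := ⟨z.1, val_det_of_mem_specialUnitaryGroupOf z⟩
  map_one' := rfl
  map_mul' _ _ := rfl

theorem specialUnitaryToSL_injective : Function.Injective (specialUnitaryToSL σ β) := fun _ _ h =>
  Subtype.ext (Units.ext (congrArg Subtype.val h))

theorem comap_center_specialUnitaryToSL [Finite K] (hK : Nat.card K = q ^ 2)
    (hσ : ∀ a, σ a = a ^ q) (hβ : β.transpose = β.map σ) (hβ' : IsUnit β.det) :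
    (Subgroup.center (Matrix.SpecialLinearGroup (Fin n) K)).comap (specialUnitaryToSL σ β) =
      Subgroup.center (specialUnitaryGroupOf σ β) := by
  ext z
  constructor
  · intro hz
    refine Subgroup.mem_center_iff.2 fun g => specialUnitaryToSL_injective ?_
    rw [map_mul, map_mul]
    exact Subgroup.mem_center_iff.1 hz _
  · intro hz
    obtain ⟨c, hc⟩ := exists_scalar_of_mem_center hK hσ hβ hβ' hz
    refine Matrix.SpecialLinearGroup.mem_center_iff.2 ⟨c, ?_, hc.symm⟩
    have := val_det_of_mem_specialUnitaryGroupOf z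
    rwa [hc, Matrix.scalar_apply, Matrix.det_diagonal, Finset.prod_const, Finset.card_univ] at this

/-- By Cauchy a central element of order `l` would exist. It is a scalar `c` of order `l`; the
determinant gives `c ^ n = 1` and the form gives `c ^ (q + 1) = 1`, so `l` divides both `n` and `q +
1`. -/
theorem not_dvd_card_center_specialUnitaryGroupOf [Finite K] (hK : Nat.card K = q ^ 2)
    (hσ : ∀ a, σ a = a ^ q) (hβ : β.transpose = β.map σ) (hβ' : IsUnit β.det) {l : ℕ}
    (hl : l.Prime) (h : ¬ l ∣ n ∨ ¬ l ∣ q + 1) :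
    ¬ l ∣ Nat.card (Subgroup.center (specialUnitaryGroupOf σ β)) := by
  intro hd
  have := Fact.mk hl
  obtain ⟨⟨z, hz⟩, hord⟩ := exists_prime_orderOf_dvd_card' l hd
  rw [Subgroup.orderOf_mk] at hord
  have hz1 : z ≠ 1 := fun h1 => hl.one_lt.ne' (by rw [← hord, h1, orderOf_one])
  have hval : (z.1 : Matrix (Fin n) (Fin n) K) ≠ 1 := fun h1 =>
    hz1 (Subtype.ext (Units.ext h1))
  obtain ⟨c, hc⟩ := exists_scalar_of_mem_center hK hσ hβ hβ' hz
  rcases isEmpty_or_nonempty (Fin n) with _ | _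
  · exact hval (Subsingleton.elim _ _)
  have hinj : Function.Injective (Matrix.scalar (Fin n) : K →+* Matrix (Fin n) (Fin n) K) :=
    fun _ _ h => Matrix.scalar_inj.1 h
  have hc1 : c ≠ 1 := fun h1 => hval (by rw [hc, h1, map_one])
  have hcl : c ^ l = 1 := hinj (by
    rw [map_pow, ← hc, map_one, ← Units.val_pow_eq_pow_val]
    have h2 : z ^ l = 1 := by rw [← hord, pow_orderOf_eq_one]
    exact congrArg (fun x : specialUnitaryGroupOf σ β => (x.1 : Matrix (Fin n) (Fin n) K)) h2)
  have hordc : orderOf c = l := orderOf_eq_prime hcl hc1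
  have hcn : c ^ n = 1 := by
    have := val_det_of_mem_specialUnitaryGroupOf z
    rwa [hc, Matrix.scalar_apply, Matrix.det_diagonal, Finset.prod_const, Finset.card_univ,
      Fintype.card_fin] at this
  have hcq : c ^ (q + 1) = 1 := by
    have h2 := mem_unitaryGroupOf.1 z.2.1
    have h3 : ((z.1 : Matrix (Fin n) (Fin n) K)).map σ = Matrix.scalar (Fin n) (σ c) := by
      rw [hc, Matrix.scalar_apply, Matrix.scalar_apply, Matrix.diagonal_map (map_zero σ)]
    rw [h3, hc, Matrix.scalar_apply, Matrix.diagonal_transpose, ← Matrix.scalar_apply,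
      (Matrix.scalar_commute (σ c) (fun r => Commute.all _ r) _).eq.symm, ← mul_assoc, ← map_mul,
      hσ, ← pow_succ] at h2
    have h4 := congrArg (fun x => x * β⁻¹) h2
    simp only [mul_assoc, Matrix.mul_nonsing_inv _ hβ', mul_one] at h4
    exact hinj (by rw [h4, map_one])
  rcases h with h | h
  · exact h (hordc ▸ orderOf_dvd_of_pow_eq_one hcn)
  · exact h (hordc ▸ orderOf_dvd_of_pow_eq_one hcq)

end Center

theorem conjFq_apply (p : ℕ) [Fact p.Prime] (r : ℕ) (a : GaloisField p (2 * r)) :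
    conjFq p r a = a ^ p ^ r :=
  iterateFrobenius_def p r a

theorem theorem11p1 (p : ℕ) [Fact p.Prime] (r : ℕ) (hr : 0 < r) (n : ℕ)
    (l : ℕ) (hl : l.Prime) (hl2 : l ≠ 2) (hlp : l ≠ p)
    (k : Type u) [Field k] (hk : ringChar k ≠ l)
    (β : Matrix (Fin n) (Fin n) (GaloisField p (2 * r)))
    (hβ : β.transpose = β.map (conjFq p r)) (hβ' : IsUnit β.det) :
    ((¬ l ∣ n ∨ ¬ l ∣ p ^ r + 1) →
      essentialDimensionAt k (PSU p r n β) l = essentialDimensionAt k (SU p r n β) l) ∧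
    ((l ∣ n ∧ l ∣ p ^ r + 1) →
      essentialDimensionAt k (PSU p r n β) l =
        essentialDimensionAt k
          (Matrix.ProjectiveSpecialLinearGroup (Fin n) (GaloisField p (2 * r))) l ∧
      ∀ (P : Sylow l (PSU p r n β))
        (Q : Sylow l (Matrix.ProjectiveSpecialLinearGroup (Fin n) (GaloisField p (2 * r)))),
        Nonempty (P ≃* Q)) := by
  have hK : Nat.card (GaloisField p (2 * r)) = (p ^ r) ^ 2 := by
    rw [GaloisField.card p (2 * r) (by omega), ← pow_mul, mul_comm]
  have : Finite (GaloisField p (2 * r)) := Nat.finite_of_card_ne_zero (by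
    rw [hK]; exact pow_ne_zero _ (pow_ne_zero _ (Fact.out : p.Prime).ne_zero))
  have := Fact.mk hl
  have hσ := conjFq_apply p r
  refine ⟨fun h => essentialDimensionAt_quotient_eq k hl _
    (not_dvd_card_center_specialUnitaryGroupOf hK hσ hβ hβ' hl h), fun h => ?_⟩
  have hcenter := comap_center_specialUnitaryToSL hK hσ hβ hβ'
  have hinj := centerQuotientMap_injective _ hcenter
  have hindex := not_dvd_index_range_centerQuotientMap (l := l) _ specialUnitaryToSL_injective
    hcenter (padicValNat_card_specialLinearGroup_le hK hσ hβ hβ' hl2 h.2)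
  exact ⟨essentialDimensionAt_eq_of_injective k hl _ hinj hindex,
    nonempty_sylow_mulEquiv_of_injective _ hinj hindex⟩
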